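/- **Theorem 4.2.** Let $r,d$ be positive integers, $\lambda\ge 0$, $A\in\mathbb R^{r\times d}$, $b\in\mathbb R^r$, $u_0\in\mathbb R^d$, and let $\pi_1,\pi_2>0$ with $\pi_1+\pi_2=1$. For $u\in\mathbb R^d$ put $$\Phi(u)=\tfrac12\|Au-b\|_2^2+\lambda\|u\|_1,\qquad \Gamma(u)=\frac{\pi_2^2}{\pi_1}\big\|A^\top(Au-b)\big\|_2^2+\frac{\pi_1^2}{\pi_2}(\lambda d)^2,$$ and let $\Theta(u)$ be the set of all $\eta\in\mathbb R^d$ such that, for each $i$, $\eta_i=1$ if $u_i>0$, $\eta_i\in[-1,1]$ if $u_i=0$, and $\eta_i=-1$ if $u_i<0$. Let $u:[0,\infty)\to\mathbb R^d$ be the gradient flow of $\Phi$ from $u_0$, that is, the (existing and unique) locally absolutely continuous function with $u(0)=u_0$ and $$-\dot u(t)\in A^\top(Au(t)-b)+\lambda\,\Theta(u(t))\quad\text{for a.e. } t>0 .$$ Let $(j_k)_{k\ge1}$ be independent random variables with $\mathbb P(j_k=1)=\pi_1$ and $\mathbb P(j_k=2)=\pi_2$. For every $\varepsilon>0$ and every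 realization of $(j_k)$ there exists a unique locally absolutely continuous function $v_\varepsilon:[0,\infty)\to\mathbb R^d$ with $v_\varepsilon(0)=u_0$ such that, for every $k\ge 1$ and a.e. $t\in[(k-1)\varepsilon,k\varepsilon)$, $$-\dot v_\varepsilon(t)=\tfrac1{\pi_1}A^\top(Av_\varepsilon(t)-b)\ \text{ if } j_k=1,\qquad -\dot v_\varepsilon(t)\in\tfrac{\lambda}{\pi_2}\,\Theta(v_\varepsilon(t))\ \text{ if } j_k=2 .$$ Moreover, $v_\varepsilon$ is locally Lipschitz on $[0,\infty)$, each $v_\varepsilon(t)$ is a random variable, the expectations below are finite, and: 1. For every $T>0$ there exists $c_T>0$ such that $$\sup_{t\in[0,T]}\mathbb E\|v_\varepsilon(t)-u(t)\|_2^2\le c_T\,\varepsilon\int_0^T\Gamma(u(s))\,ds\qquad\text{for all }\varepsilon>0 .$$ 2. For every $\eta>0$ there exists $T>0$ such that $\mathbb E\,\Phi(v_\varepsilon(T))\le\inf_{v\in\mathbb R^d}\Phi(v)+\eta$ for all sufficiently small $\varepsilon>0$. 3. There exists a minimizer $u^*$ of $\Phi$ over $\mathbb R^d$ such that for every $\eta>0$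 there exists $T>0$ with $\mathbb E\|v_\varepsilon(T)-u^*\|_2^2\le\eta$ for all sufficiently small $\varepsilon>0$. Here $c_T$ may depend on $T$ and on all the data fixed above, including $u_0$, but not on $\varepsilon$ or $t$. -/

import Mathlib

open Set MeasureTheory ProbabilityTheory
open scoped Pointwise

noncomputable section

namespace SparseInversion

/-- `ℝ^n` with the Euclidean norm. -/
abbrev E (n : ℕ) : Type := EuclideanSpace ℝ (Fin n)

/-- The `ℓ¹` norm on `ℝ^d`. -/
def l1Norm {d : ℕ} (u : E d) : ℝ := ∑ i, |u i|

/-- The objective `Φ(u) = ½ ‖A u - b‖₂² + lam ‖u‖₁`. -/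
def objective {r d : ℕ} (A : Matrix (Fin r) (Fin d) ℝ) (b : E r) (lam : ℝ) (u : E d) : ℝ :=
  1 / 2 * ‖Matrix.toEuclideanLin A u - b‖ ^ 2 + lam * l1Norm u

/-- The least-squares gradient `Aᵀ (A u - b)`. -/
def lsGrad {r d : ℕ} (A : Matrix (Fin r) (Fin d) ℝ) (b : E r) (u : E d) : E d :=
  Matrix.toEuclideanLin A.transpose (Matrix.toEuclideanLin A u - b)

/-- The set-valued sign map `Θ`, coordinate by coordinate. -/
def signSet {d : ℕ} (u : E d) : Set (E d) :=
  {η | ∀ i, (0 < u i → η i = 1) ∧ (u i = 0 → η i ∈ Icc (-1 : ℝ) 1) ∧ (u i < 0 → η i = -1)}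

/-- Local absolute continuity on `[0, ∞)`. Functions on `[0, ∞)` are represented by functions
`ℝ → E d` of which only the values on `[0, ∞)` matter. -/
def LocallyAC {d : ℕ} (v : ℝ → E d) : Prop :=
  ∀ T : ℝ, 0 < T → AbsolutelyContinuousOnInterval v 0 T

/-- `u` is a strong solution on `[0, ∞)` of the sparse inversion flow
`-u' ∈ Aᵀ (A u - b) + lam Θ(u)`, `u(0) = u₀`. -/
structure IsSparseFlow {r d : ℕ} (A : Matrix (Fin r) (Fin d) ℝ) (b : E r) (lam : ℝ) (u₀ : E d)
    (u : ℝ → E d) : Prop where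
  locallyAC : LocallyAC u
  initial : u 0 = u₀
  inclusion : ∀ᵐ t ∂(volume.restrict (Ioi (0 : ℝ))), ∃ w : E d,
    HasDerivAt u w t ∧ ∃ η ∈ signSet (u t), -w = lsGrad A b (u t) + lam • η

/-- `v` is a mini-batch flow on `[0, ∞)` for the step length `ε` and the batch choices `σ`.
On the interval `[k ε, (k+1) ε)`, `k = 0, 1, 2, …`, the choice is `σ k`; the value `0` selects the
least-squares flow (batch 1) and the value `1` the `ℓ¹` shrinking flow (batch 2). -/
structure IsMiniBatchFlow {r d : ℕ} (A : Matrix (Fin r) (Fin d) ℝ) (b : E r) (lam π₁ π₂ : ℝ)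
    (u₀ : E d) (ε : ℝ) (σ : ℕ → Fin 2) (v : ℝ → E d) : Prop where
  locallyAC : LocallyAC v
  initial : v 0 = u₀
  leastSquares : ∀ k : ℕ, σ k = 0 →
    ∀ᵐ t ∂(volume.restrict (Ico ((k : ℝ) * ε) (((k : ℝ) + 1) * ε))), ∃ w : E d,
      HasDerivAt v w t ∧ -w = (1 / π₁) • lsGrad A b (v t)
  shrinking : ∀ k : ℕ, σ k = 1 →
    ∀ᵐ t ∂(volume.restrict (Ico ((k : ℝ) * ε) (((k : ℝ) + 1) * ε))), ∃ w : E d,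
      HasDerivAt v w t ∧ -w ∈ (lam / π₂) • signSet (v t)

/-- A sequence of independent random batch choices; batch 1 (value `0`) is chosen with
probability `π₁`, batch 2 (value `1`) with probability `π₂`. -/
structure IsBatchSequence {Ω : Type*} [MeasurableSpace Ω] (P : Measure Ω) (π₁ π₂ : ℝ)
    (j : ℕ → Ω → Fin 2) : Prop where
  measurable : ∀ k, Measurable (j k)
  indep : iIndepFun j P
  prob_one : ∀ k, P.real {ω | j k ω = 0} = π₁
  prob_two : ∀ k, P.real {ω | j k ω = 1} = π₂

/-- `Γ(u) = (π₂²/π₁) ‖Aᵀ (A u - b)‖₂² + (π₁²/π₂) (lam d)²`. -/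
def Gam {r d : ℕ} (A : Matrix (Fin r) (Fin d) ℝ) (b : E r) (lam π₁ π₂ : ℝ) (u : E d) : ℝ :=
  π₂ ^ 2 / π₁ * ‖lsGrad A b u‖ ^ 2 + π₁ ^ 2 / π₂ * (lam * d) ^ 2

end SparseInversion

end

section

open Filter Topology
open scoped RealInnerProductSpace NNReal

/-! ### Absolutely continuous curves: monotonicity, increments and growth. -/

section AbsolutelyContinuous

/-! All flows are treated as one inclusion `-v' ∈ a(t) F(v) + m(t) Θ(v)` with `F` monotone and
Lipschitz and `a, m ≥ 0`. Since `Θ` is monotone, two solutions with the same coefficients never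
separate; this gives uniqueness. Existence comes from replacing `Θ` by its Yosida regularization
`clip μ`: the regularized solutions are Cauchy as `μ → 0`, and the limit solves the inclusion
(`flowAt_of_tendsto_regularized`). Solutions on short intervals are then glued.

The mean square estimate rests on `norm_sub_sq_le_of_step`. Over one step starting at `s`, the
differences of `F` and of `Θ` only bring `v` and `u` together. What remains is the deviation of the
random rates from their mean 1, tested against `v - u`. Replacing `v - u` by its value at `s` costs
a quadratic error in the step length, because all curves are Lipschitz with a common constant. The
frozen term is a centred function of the current choice times a function of earlier choices, so its
expectation vanishes by independence. About `T/ε` errors of size `ε²` add up to `O(ε)`;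
dissipativity makes a Gronwall factor unnecessary.

The factor `∫ Γ(u)` is then a normalization. If `Γ(u₀) > 0`, the integral is positive and the
constant can be divided by it. If `Γ(u₀) = 0`, then `lam = 0` and the gradient vanishes at `u₀`, so
every flow stays at `u₀`.

For the last two claims, the deterministic flow is Fejér monotone with respect to minimizers and
comes arbitrarily close to one of them (`exists_minimizer_forall_norm_sub_le`). Fix `T` with `u(T)`
close to it, then take `ε` small. -/

theorem LipschitzWith.comp_absolutelyContinuousOnInterval {X Y : Type*} [PseudoMetricSpace X]
    [PseudoMetricSpace Y] {φ : X → Y} {K : ℝ≥0} (hφ : LipschitzWith K φ) {f : ℝ → X} {a b : ℝ}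
    (hf : AbsolutelyContinuousOnInterval f a b) :
    AbsolutelyContinuousOnInterval (fun t => φ (f t)) a b := by
  have hK := Tendsto.const_mul (K : ℝ) hf
  rw [mul_zero] at hK
  refine squeeze_zero (fun t => Finset.sum_nonneg fun i _ => dist_nonneg) (fun t => ?_) hK
  rw [Finset.mul_sum]
  exact Finset.sum_le_sum fun i _ => hφ.dist_le_mul _ _

theorem AbsolutelyContinuousOnInterval.norm_sq {V : Type*} [NormedAddCommGroup V]
    {f : ℝ → V} {a b : ℝ}
    (hf : AbsolutelyContinuousOnInterval f a b) :
    AbsolutelyContinuousOnInterval (fun t => ‖f t‖ ^ 2) a b := by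
  have h := lipschitzWith_one_norm.comp_absolutelyContinuousOnInterval hf
  simpa only [sq] using h.fun_mul h

variable {V : Type*} [NormedAddCommGroup V] [InnerProductSpace ℝ V]

theorem AbsolutelyContinuousOnInterval.inner_const {f : ℝ → V} {a b : ℝ}
    (hf : AbsolutelyContinuousOnInterval f a b) (e : V) :
    AbsolutelyContinuousOnInterval (fun t => ⟪e, f t⟫) a b :=
  (innerSL ℝ e).lipschitz.comp_absolutelyContinuousOnInterval hf

/-- An absolutely continuous function whose derivative is a.e. nonpositive does not increase. -/
theorem AbsolutelyContinuousOnInterval.le_of_ae_deriv_nonpos {f : ℝ → ℝ} {a b : ℝ} (hab : a ≤ b)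
    (hf : AbsolutelyContinuousOnInterval f a b)
    (h : ∀ᵐ t, t ∈ Ioo a b → ∃ f', HasDerivAt f f' t ∧ f' ≤ 0) : f b ≤ f a := by
  have h1 := hf.integral_deriv_eq_sub
  have h2 : 0 ≤ ∫ x in a..b, -deriv f x := by
    refine intervalIntegral.integral_nonneg_of_ae_restrict hab ?_
    rw [EventuallyLE, ← Measure.restrict_congr_set Ioo_ae_eq_Icc,
      ae_restrict_iff' measurableSet_Ioo]
    filter_upwards [h] with t ht hm
    obtain ⟨f', h3, h4⟩ := ht hm
    simpa [h3.deriv] using h4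
  rw [intervalIntegral.integral_neg] at h2
  linarith

/-- Testing against the increment `e = f b - f a` reduces to a scalar function: `⟪e, f t⟫ - ‖e‖ L t`
does not increase. -/
theorem AbsolutelyContinuousOnInterval.norm_sub_le_of_ae_deriv {f : ℝ → V} {a b L : ℝ}
    (hab : a ≤ b) (hL : 0 ≤ L) (hf : AbsolutelyContinuousOnInterval f a b)
    (h : ∀ᵐ t, t ∈ Ioo a b → ∃ w, HasDerivAt f w t ∧ ‖w‖ ≤ L) :
    ‖f b - f a‖ ≤ L * (b - a) := by
  set e := f b - f a with he
  have hg : AbsolutelyContinuousOnInterval (fun t => ⟪e, f t⟫ - ‖e‖ * L * t) a b := by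
    refine (hf.inner_const e).fun_sub (ContDiffOn.absolutelyContinuousOnInterval ?_)
    fun_prop
  have key := hg.le_of_ae_deriv_nonpos hab (by
    filter_upwards [h] with t ht hm
    obtain ⟨w, hw, hwL⟩ := ht hm
    refine ⟨⟪e, w⟫ - ‖e‖ * L * 1, ?_, ?_⟩
    · exact (((innerSL ℝ e).hasFDerivAt.comp_hasDerivAt t hw)).sub
        ((hasDerivAt_id t).const_mul _)
    · have := real_inner_le_norm e w
      have := mul_le_mul_of_nonneg_left hwL (norm_nonneg e)
      linarith)
  have h3 : ‖e‖ * ‖e‖ ≤ ‖e‖ * (L * (b - a)) := by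
    have : ⟪e, f b⟫ - ⟪e, f a⟫ = ‖e‖ * ‖e‖ := by
      rw [← inner_sub_right, ← he, real_inner_self_eq_norm_mul_norm]
    linarith
  rcases (norm_nonneg e).eq_or_lt with h0 | h0
  · rw [← h0]
    exact mul_nonneg hL (sub_nonneg.2 hab)
  · exact le_of_mul_le_mul_left h3 h0

/-- Gronwall: `2 c ‖f‖ ≤ c (1 + ‖f‖²)`, so `exp(-c t) (1 + ‖f‖²)` does not increase. The summand 1
absorbs the growth that is only linear in `‖f‖`. -/
theorem AbsolutelyContinuousOnInterval.one_add_norm_sq_le {f : ℝ → V} {T c : ℝ} (hT : 0 ≤ T)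
    (hc : 0 ≤ c) (hf : AbsolutelyContinuousOnInterval f 0 T)
    (h : ∀ᵐ t, t ∈ Ioo 0 T → ∃ w, HasDerivAt f w t ∧ ⟪f t, w⟫ ≤ c * ‖f t‖) :
    1 + ‖f T‖ ^ 2 ≤ Real.exp (c * T) * (1 + ‖f 0‖ ^ 2) := by
  have hg : AbsolutelyContinuousOnInterval
      (fun t => Real.exp (-c * t) * (1 + ‖f t‖ ^ 2)) 0 T := by
    refine AbsolutelyContinuousOnInterval.fun_mul (ContDiffOn.absolutelyContinuousOnInterval ?_)
      (AbsolutelyContinuousOnInterval.fun_add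
        (ContDiffOn.absolutelyContinuousOnInterval ?_) hf.norm_sq)
    · fun_prop
    · fun_prop
  have key := hg.le_of_ae_deriv_nonpos hT (by
    filter_upwards [h] with t ht hm
    obtain ⟨w, hw, hwL⟩ := ht hm
    refine ⟨_, ((((hasDerivAt_id t).const_mul (-c)).exp)).mul (hw.norm_sq.const_add 1), ?_⟩
    have h1 : 2 * ⟪f t, w⟫ ≤ c * (1 + ‖f t‖ ^ 2) := by
      nlinarith [mul_nonneg hc (sq_nonneg (‖f t‖ - 1))]
    have h2 := mul_le_mul_of_nonneg_left h1 (Real.exp_pos (-c * t)).le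
    simp only [id]
    linarith)
  simp only [mul_zero, Real.exp_zero, one_mul] at key
  have h3 := mul_le_mul_of_nonneg_left key (Real.exp_pos (c * T)).le
  rwa [← mul_assoc, ← Real.exp_add, neg_mul, add_neg_cancel, Real.exp_zero, one_mul] at h3

end AbsolutelyContinuous

namespace SparseInversion

variable {d : ℕ}

/-! ### The sign map as subdifferential of the `ℓ¹` norm. -/

section SignSet

theorem inner_eq_sum (x y : E d) : ⟪x, y⟫ = ∑ i, x i * y i := by
  simp [PiLp.inner_apply, mul_comm]

theorem signSet_nonempty (u : E d) : (signSet u).Nonempty := by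
  refine ⟨WithLp.toLp 2 fun i => SignType.sign (u i),
    fun i => ⟨fun h => ?_, fun h => ?_, fun h => ?_⟩⟩
  · simp [h]
  · simp [h]
  · simp [h]

theorem mul_eq_abs_of_mem_signSet {u η : E d} (h : η ∈ signSet u) (i : Fin d) :
    η i * u i = |u i| := by
  obtain ⟨h1, h2, h3⟩ := h i
  rcases lt_trichotomy (u i) 0 with hu | hu | hu
  · rw [h3 hu, abs_of_neg hu]; ring
  · simp [hu]
  · rw [h1 hu, abs_of_pos hu]; ring

theorem abs_le_one_of_mem_signSet {u η : E d} (h : η ∈ signSet u) (i : Fin d) : |η i| ≤ 1 := by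
  obtain ⟨h1, h2, h3⟩ := h i
  rcases lt_trichotomy (u i) 0 with hu | hu | hu
  · simp [h3 hu]
  · exact abs_le.2 (h2 hu)
  · simp [h1 hu]

theorem norm_le_sqrt_of_forall_abs_le_one {η : E d} (h : ∀ i, |η i| ≤ 1) :
    ‖η‖ ≤ Real.sqrt d := by
  rw [EuclideanSpace.norm_eq]
  refine Real.sqrt_le_sqrt ?_
  calc ∑ i, ‖η i‖ ^ 2 ≤ ∑ _i : Fin d, (1 : ℝ) :=
        Finset.sum_le_sum fun i _ => pow_le_one₀ (norm_nonneg _) (h i)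
    _ = d := by simp

theorem norm_le_of_mem_signSet {u η : E d} (h : η ∈ signSet u) : ‖η‖ ≤ Real.sqrt d :=
  norm_le_sqrt_of_forall_abs_le_one (abs_le_one_of_mem_signSet h)

/-- Together with equality at `y = u`, proved next, this makes `η` a subgradient of the `ℓ¹` norm at
`u`. The monotonicity of `Θ` and the subgradient inequality for the objective both follow from this
pair. -/
theorem inner_le_l1Norm_of_mem_signSet {u η : E d} (h : η ∈ signSet u) (y : E d) :
    ⟪η, y⟫ ≤ l1Norm y := by
  rw [inner_eq_sum]
  refine Finset.sum_le_sum fun i _ => (le_abs_self _).trans ?_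
  rw [abs_mul]
  exact mul_le_of_le_one_left (abs_nonneg _) (abs_le_one_of_mem_signSet h i)

theorem inner_eq_l1Norm_of_mem_signSet {u η : E d} (h : η ∈ signSet u) : ⟪η, u⟫ = l1Norm u := by
  rw [inner_eq_sum]
  exact Finset.sum_congr rfl fun i _ => mul_eq_abs_of_mem_signSet h i

theorem l1Norm_nonneg (u : E d) : 0 ≤ l1Norm u := Finset.sum_nonneg fun _ _ => abs_nonneg _

/-- The set-valued sign map is monotone. -/
theorem signSet_monotone {u v η ζ : E d} (hη : η ∈ signSet u) (hζ : ζ ∈ signSet v) :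
    0 ≤ ⟪η - ζ, u - v⟫ := by
  have h1 := inner_eq_l1Norm_of_mem_signSet hη
  have h2 := inner_eq_l1Norm_of_mem_signSet hζ
  have h3 := inner_le_l1Norm_of_mem_signSet hη v
  have h4 := inner_le_l1Norm_of_mem_signSet hζ u
  simp only [inner_sub_left, inner_sub_right]
  linarith

end SignSet

/-! ### The general inclusion: a priori bounds, contraction, uniqueness. -/

section Flow

/-- The pointwise inclusion `-v'(t) ∈ a F(v(t)) + m Θ(v(t))`. -/
def FlowAt (F : E d → E d) (a m : ℝ) (v : ℝ → E d) (t : ℝ) : Prop :=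
  ∃ w, HasDerivAt v w t ∧ ∃ η ∈ signSet (v t), -w = a • F (v t) + m • η

/-- `v` is absolutely continuous on `[0, T]` and solves `-v' ∈ a(t) F(v) + m(t) Θ(v)` there. -/
structure IsFlowOn (F : E d → E d) (a m : ℝ → ℝ) (T : ℝ) (v : ℝ → E d) : Prop where
  absolutelyContinuous : AbsolutelyContinuousOnInterval v 0 T
  flowAt : ∀ᵐ t, t ∈ Ioo 0 T → FlowAt F (a t) (m t) v t

/-- Monotone vector fields. -/
def IsMonotone (F : E d → E d) : Prop := ∀ x y, 0 ≤ ⟪F x - F y, x - y⟫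

variable {F : E d → E d} {a m : ℝ → ℝ} {T : ℝ} {v w : ℝ → E d}

theorem IsFlowOn.mono (h : IsFlowOn F a m T v) {T' : ℝ} (h0 : 0 ≤ T') (hT : T' ≤ T) :
    IsFlowOn F a m T' v where
  absolutelyContinuous := h.absolutelyContinuous.mono (by
    rw [uIcc_of_le h0, uIcc_of_le (h0.trans hT)]; exact Icc_subset_Icc_right hT)
  flowAt := by
    filter_upwards [h.flowAt] with t ht hm
    exact ht ⟨hm.1, hm.2.trans_le hT⟩

theorem IsFlowOn.congr_coeff (h : IsFlowOn F a m T v) {a' m' : ℝ → ℝ}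
    (ha : ∀ t ∈ Ioo 0 T, a t = a' t) (hm : ∀ t ∈ Ioo 0 T, m t = m' t) :
    IsFlowOn F a' m' T v where
  absolutelyContinuous := h.absolutelyContinuous
  flowAt := by
    filter_upwards [h.flowAt] with t ht htT
    rw [← ha t htT, ← hm t htT]
    exact ht htT

theorem IsFlowOn.continuousOn (h : IsFlowOn F a m T v) (hT : 0 ≤ T) : ContinuousOn v (Icc 0 T) := by
  simpa [uIcc_of_le hT] using h.absolutelyContinuous.continuousOn

theorem IsFlowOn.ae_flowAt_Ioo (h : IsFlowOn F a m T v) {s t : ℝ} (hs : 0 ≤ s) (ht : t ≤ T) :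
    ∀ᵐ r, r ∈ Ioo s t → FlowAt F (a r) (m r) v r := by
  filter_upwards [h.flowAt] with r hr hm
  exact hr ⟨hs.trans_lt hm.1, hm.2.trans_le ht⟩

theorem IsFlowOn.absolutelyContinuous_Icc (h : IsFlowOn F a m T v) {s t : ℝ} (hs : 0 ≤ s)
    (hst : s ≤ t) (ht : t ≤ T) : AbsolutelyContinuousOnInterval v s t :=
  h.absolutelyContinuous.mono (by
    rw [uIcc_of_le hst, uIcc_of_le (hs.trans (hst.trans ht))]; exact Icc_subset_Icc hs ht)

theorem norm_le_of_lipschitzWith {K : ℝ≥0} (hF : LipschitzWith K F) (x : E d) :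
    ‖F x‖ ≤ K * ‖x‖ + ‖F 0‖ := by
  have h1 := hF.norm_sub_le x 0
  have h2 := norm_sub_norm_le (F x) (F 0)
  rw [sub_zero] at h1
  linarith

/-- Bounds for the curves with `-v' = a(t) F(v) + m(t) η(t)`, where `η` is bounded and does not
increase the norm, that depend only on bounds for the data. -/
theorem exists_forall_norm_le_and_lipschitz {K : ℝ≥0} (hF : LipschitzWith K F) (hmon : IsMonotone F)
    (M N T : ℝ) (x₀ : E d) (hM : 0 ≤ M) (hN : 0 ≤ N) :
    ∃ R L : ℝ, 0 ≤ R ∧ 0 ≤ L ∧ ∀ (a m : ℝ → ℝ) (v : ℝ → E d),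
      (∀ t, 0 ≤ a t ∧ a t ≤ M) → (∀ t, 0 ≤ m t ∧ m t ≤ N) → AbsolutelyContinuousOnInterval v 0 T →
      (∀ᵐ t, t ∈ Ioo 0 T → ∃ w, HasDerivAt v w t ∧ ∃ η : E d, ‖η‖ ≤ Real.sqrt d ∧ 0 ≤ ⟪η, v t⟫ ∧
        -w = a t • F (v t) + m t • η) → v 0 = x₀ →
      (∀ t ∈ Icc 0 T, ‖v t‖ ≤ R) ∧
      ∀ s t, 0 ≤ s → s ≤ t → t ≤ T → ‖v t - v s‖ ≤ L * (t - s) := by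
  -- Monotonicity gives `⟪F v, v⟫ ≥ ⟪F 0, v⟫`, so only `‖F 0‖` enters the growth rate. The two
  -- conditions on `η` hold for elements of `Θ` and for `clip`, so the bounds also serve the
  -- regularized flows.
  set c := M * ‖F 0‖ with hc
  have hc0 : 0 ≤ c := by positivity
  set R := Real.exp (c * T) * (1 + ‖x₀‖ ^ 2) with hR
  have hR0 : 0 ≤ R := by positivity
  refine ⟨R, M * (K * R + ‖F 0‖) + N * Real.sqrt d, hR0, by positivity, ?_⟩
  intro a m v ha hm hac hv hv0
  have hsub : ∀ s t, 0 ≤ s → s ≤ t → t ≤ T → AbsolutelyContinuousOnInterval v s t :=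
    fun s t hs hst ht => hac.mono (by
      rw [uIcc_of_le hst, uIcc_of_le (hs.trans (hst.trans ht))]; exact Icc_subset_Icc hs ht)
  have hbd : ∀ t ∈ Icc 0 T, ‖v t‖ ≤ R := by
    intro t ht
    have h1 := (hsub 0 t le_rfl ht.1 ht.2).one_add_norm_sq_le (c := c) ht.1 hc0 (by
      filter_upwards [hv] with r hr hrt
      obtain ⟨w, hw, η, -, h3, hwe⟩ := hr ⟨hrt.1, hrt.2.trans_le ht.2⟩
      refine ⟨w, hw, ?_⟩
      have h2 : 0 ≤ ⟪F (v r) - F 0, v r⟫ := by simpa using hmon (v r) 0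
      have h4 : w = -(a r • F (v r) + m r • η) := by rw [← hwe, neg_neg]
      have h5 : -⟪F 0, v r⟫ ≤ ‖F 0‖ * ‖v r‖ := by
        have := abs_real_inner_le_norm (F 0) (v r)
        linarith [neg_abs_le ⟪F 0, v r⟫]
      rw [real_inner_comm, h4, inner_neg_left, inner_add_left, real_inner_smul_left,
        real_inner_smul_left]
      rw [inner_sub_left] at h2
      have h6 := mul_nonneg (ha r).1 h2
      have h7 := mul_nonneg (hm r).1 h3
      have h8 := mul_le_mul_of_nonneg_left h5 (ha r).1
      have h9 := mul_le_mul_of_nonneg_right (ha r).2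
        (mul_nonneg (norm_nonneg (F 0)) (norm_nonneg (v r)))
      rw [hc]
      linarith)
    have h2 : Real.exp (c * t) * (1 + ‖v 0‖ ^ 2) ≤ R := by
      rw [hv0, hR]
      have := ht.2
      gcongr
    nlinarith [sq_nonneg (‖v t‖ - 1)]
  refine ⟨hbd, fun s t hs hst ht => ?_⟩
  refine (hsub s t hs hst ht).norm_sub_le_of_ae_deriv hst (by positivity) ?_
  filter_upwards [hv] with r hr hrt
  obtain ⟨w, hw, η, hη, -, hwe⟩ := hr ⟨hs.trans_lt hrt.1, hrt.2.trans_le ht⟩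
  refine ⟨w, hw, ?_⟩
  rw [← norm_neg, hwe]
  refine (norm_add_le _ _).trans ?_
  rw [norm_smul, norm_smul, Real.norm_of_nonneg (ha r).1, Real.norm_of_nonneg (hm r).1]
  have h1 := norm_le_of_lipschitzWith hF (v r)
  have h2 := hbd r ⟨hs.trans hrt.1.le, hrt.2.le.trans ht⟩
  have h3 : ‖F (v r)‖ ≤ K * R + ‖F 0‖ := h1.trans (by gcongr)
  exact add_le_add (mul_le_mul (ha r).2 h3 (norm_nonneg _) hM)
    (mul_le_mul (hm r).2 hη (norm_nonneg _) hN)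

/-- Bounds on a flow and its Lipschitz constant that depend only on bounds for the data. -/
theorem exists_forall_isFlowOn_bounds {K : ℝ≥0} (hF : LipschitzWith K F) (hmon : IsMonotone F)
    (M N T : ℝ) (x₀ : E d) (hM : 0 ≤ M) (hN : 0 ≤ N) :
    ∃ R L : ℝ, 0 ≤ R ∧ 0 ≤ L ∧ ∀ (a m : ℝ → ℝ) (v : ℝ → E d),
      (∀ t, 0 ≤ a t ∧ a t ≤ M) → (∀ t, 0 ≤ m t ∧ m t ≤ N) → IsFlowOn F a m T v → v 0 = x₀ →
      (∀ t ∈ Icc 0 T, ‖v t‖ ≤ R) ∧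
      ∀ s t, 0 ≤ s → s ≤ t → t ≤ T → ‖v t - v s‖ ≤ L * (t - s) := by
  obtain ⟨R, L, hR, hL, h⟩ := exists_forall_norm_le_and_lipschitz hF hmon M N T x₀ hM hN
  refine ⟨R, L, hR, hL, fun a m v ha hm hv => h a m v ha hm hv.absolutelyContinuous ?_⟩
  filter_upwards [hv.flowAt] with t ht hm
  obtain ⟨w, hw, η, hη, hwe⟩ := ht hm
  refine ⟨w, hw, η, norm_le_of_mem_signSet hη, ?_, hwe⟩
  rw [inner_eq_l1Norm_of_mem_signSet hη]
  exact l1Norm_nonneg _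

/-- Two flows with the same coefficients do not move apart. -/
theorem IsFlowOn.norm_sub_le (hmon : IsMonotone F) (ha : ∀ t, 0 ≤ a t) (hm : ∀ t, 0 ≤ m t)
    (hv : IsFlowOn F a m T v) (hw : IsFlowOn F a m T w) {s t : ℝ} (hs : 0 ≤ s) (hst : s ≤ t)
    (ht : t ≤ T) : ‖v t - w t‖ ≤ ‖v s - w s‖ := by
  have h1 := ((hv.absolutelyContinuous_Icc hs hst ht).fun_sub
    (hw.absolutelyContinuous_Icc hs hst ht)).norm_sq.le_of_ae_deriv_nonpos hst (by
      filter_upwards [hv.ae_flowAt_Ioo hs ht, hw.ae_flowAt_Ioo hs ht] with r h1 h2 hr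
      obtain ⟨p, hp, η, hη, hpe⟩ := h1 hr
      obtain ⟨q, hq, ζ, hζ, hqe⟩ := h2 hr
      refine ⟨_, (hp.fun_sub hq).norm_sq, ?_⟩
      have h3 : p - q = -(a r • (F (v r) - F (w r)) + m r • (η - ζ)) := by
        rw [← neg_neg p, ← neg_neg q, hpe, hqe]; module
      have h4 := mul_nonneg (ha r) (hmon (v r) (w r))
      have h5 := mul_nonneg (hm r) (signSet_monotone hη hζ)
      rw [h3, real_inner_comm, inner_neg_left, inner_add_left, real_inner_smul_left,
        real_inner_smul_left]
      linarith)
  exact (sq_le_sq₀ (norm_nonneg _) (norm_nonneg _)).1 h1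

theorem IsFlowOn.eqOn (hmon : IsMonotone F) (ha : ∀ t, 0 ≤ a t) (hm : ∀ t, 0 ≤ m t)
    (hv : IsFlowOn F a m T v) (hw : IsFlowOn F a m T w) (h0 : v 0 = w 0) :
    EqOn v w (Icc 0 T) := by
  intro t ht
  have h := hv.norm_sub_le hmon ha hm hw le_rfl ht.1 ht.2
  rw [h0, sub_self, norm_zero] at h
  exact sub_eq_zero.1 (norm_le_zero_iff.1 h)

end Flow

end SparseInversion

namespace SparseInversion

variable {d : ℕ}

/-! ### Yosida regularization of the sign map. -/

section Regularization

/-- The Yosida regularization of the sign map. -/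
noncomputable def clip (μ : ℝ) (x : E d) : E d := WithLp.toLp 2 fun i => max (-1) (min 1 (x i / μ))

theorem clip_apply (μ : ℝ) (x : E d) (i : Fin d) : clip μ x i = max (-1) (min 1 (x i / μ)) := rfl

theorem abs_clip_le_one (μ : ℝ) (x : E d) (i : Fin d) : |clip μ x i| ≤ 1 := by
  rw [clip_apply, abs_le]
  exact ⟨le_max_left _ _, max_le (by norm_num) (min_le_left _ _)⟩

theorem clip_apply_of_le {μ : ℝ} (hμ : 0 < μ) {x : E d} {i : Fin d} (h : μ ≤ x i) :
    clip μ x i = 1 := by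
  rw [clip_apply, min_eq_left ((one_le_div hμ).2 h)]
  norm_num

theorem clip_apply_of_le_neg {μ : ℝ} (hμ : 0 < μ) {x : E d} {i : Fin d} (h : x i ≤ -μ) :
    clip μ x i = -1 := by
  have : x i / μ ≤ -1 := (div_le_iff₀ hμ).2 (by linarith)
  rw [clip_apply, min_eq_right (this.trans (by norm_num)), max_eq_left this]

/-- The point `x - μ clip μ x` is the soft thresholding of `x`, that is, the resolvent of `Θ`. This
transfers monotonicity from `Θ` to `clip`, at the price of shifting the points by at most `μ √d`. -/
theorem clip_mem_signSet {μ : ℝ} (hμ : 0 < μ) (x : E d) :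
    clip μ x ∈ signSet (x - μ • clip μ x) := by
  intro i
  have hx : (x - μ • clip μ x) i = x i - μ * clip μ x i := rfl
  rw [hx]
  have hb := abs_le.1 (abs_clip_le_one μ x i)
  rcases le_total μ (x i) with h | h
  · rw [clip_apply_of_le hμ h]
    exact ⟨fun _ => rfl, fun _ => by norm_num, fun h' => by linarith⟩
  rcases le_total (x i) (-μ) with h2 | h2
  · rw [clip_apply_of_le_neg hμ h2]
    exact ⟨fun h' => by linarith, fun _ => by norm_num, fun _ => rfl⟩
  · have h3 : clip μ x i = x i / μ := by
      rw [clip_apply, min_eq_right ((div_le_one hμ).2 h),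
        max_eq_right ((le_div_iff₀ hμ).2 (by linarith))]
    have h4 : x i - μ * clip μ x i = 0 := by
      rw [h3]; field_simp; ring
    rw [h4]
    exact ⟨fun h' => absurd h' (lt_irrefl _), fun _ => hb, fun h' => absurd h' (lt_irrefl _)⟩

theorem lipschitzWith_clip {μ : ℝ} (hμ : 0 < μ) :
    LipschitzWith (Real.toNNReal μ⁻¹) (clip μ : E d → E d) := by
  refine LipschitzWith.of_dist_le_mul fun x y => ?_
  rw [Real.coe_toNNReal _ (inv_pos.2 hμ).le, dist_eq_norm, dist_eq_norm]
  refine (sq_le_sq₀ (norm_nonneg _) (by positivity)).1 ?_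
  rw [mul_pow, EuclideanSpace.real_norm_sq_eq, EuclideanSpace.real_norm_sq_eq, Finset.mul_sum]
  refine Finset.sum_le_sum fun i _ => ?_
  rw [← mul_pow]
  refine sq_le_sq.2 ?_
  rw [PiLp.sub_apply, PiLp.sub_apply, clip_apply, clip_apply, ← mul_comm (x i - y i), sub_mul,
    ← div_eq_mul_inv, ← div_eq_mul_inv]
  refine (abs_max_sub_max_le_max _ _ _ _).trans (max_le (by simp) ?_)
  exact (abs_min_sub_min_le_max _ _ _ _).trans (max_le (by simp) le_rfl)

theorem norm_clip_le (μ : ℝ) (x : E d) : ‖clip μ x‖ ≤ Real.sqrt d :=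
  norm_le_sqrt_of_forall_abs_le_one (abs_clip_le_one μ x)

theorem inner_clip_nonneg {μ : ℝ} (hμ : 0 < μ) (x : E d) : 0 ≤ ⟪clip μ x, x⟫ := by
  rw [inner_eq_sum]
  refine Finset.sum_nonneg fun i _ => ?_
  rw [clip_apply]
  rcases le_total 0 (x i) with h | h
  · exact mul_nonneg (le_max_of_le_right (le_min zero_le_one (div_nonneg h hμ.le))) h
  · refine mul_nonneg_of_nonpos_of_nonpos (max_le (by norm_num) ?_) h
    exact min_le_of_right_le (div_nonpos_of_nonpos_of_nonneg h hμ.le)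

/-- Regularized sign maps for different parameters are monotone with respect to each other up to
an error. -/
theorem neg_le_inner_clip_sub_clip {μ ν : ℝ} (hμ : 0 < μ) (hν : 0 < ν) (x y : E d) :
    -(2 * d * (μ + ν)) ≤ ⟪clip μ x - clip ν y, x - y⟫ := by
  have h1 := signSet_monotone (clip_mem_signSet hμ x) (clip_mem_signSet hν y)
  set p := clip μ x with hp
  set q := clip ν y with hq
  have hpn : ‖p‖ ≤ Real.sqrt d := norm_clip_le μ x
  have hqn : ‖q‖ ≤ Real.sqrt d := norm_clip_le ν y
  -- Monotonicity of `Θ` controls the difference of the resolvents, Cauchy–Schwarz the remaining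
  -- shift.
  have h2 : x - y = (x - μ • p - (y - ν • q)) + (μ • p - ν • q) := by abel
  have h3 : ‖p - q‖ ≤ 2 * Real.sqrt d := (norm_sub_le _ _).trans (by linarith)
  have h4 : ‖μ • p - ν • q‖ ≤ (μ + ν) * Real.sqrt d := by
    refine (norm_sub_le _ _).trans ?_
    rw [norm_smul, norm_smul, Real.norm_of_nonneg hμ.le, Real.norm_of_nonneg hν.le, add_mul]
    gcongr
  have h5 := neg_le_of_abs_le (abs_real_inner_le_norm (p - q) (μ • p - ν • q))
  have h6 : ‖p - q‖ * ‖μ • p - ν • q‖ ≤ 2 * Real.sqrt d * ((μ + ν) * Real.sqrt d) := by gcongr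
  have h7 : Real.sqrt d * Real.sqrt d = d := Real.mul_self_sqrt (Nat.cast_nonneg d)
  rw [h2, inner_add_right]
  nlinarith

/-- The regularized flow exists on a time interval that does not depend on the regularization
parameter. -/
theorem exists_regularized_flow {F : E d → E d} {K : ℝ≥0} (hF : LipschitzWith K F) {a m μ τ : ℝ}
    (ha : 0 ≤ a) (hm : 0 ≤ m) (hμ : 0 < μ) (hτ : 0 ≤ τ) (haτ : a * K * τ ≤ 1 / 2) (x₀ : E d) :
    ∃ v : ℝ → E d, v 0 = x₀ ∧ ∀ t ∈ Icc 0 τ,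
      HasDerivWithinAt v (-(a • F (v t) + m • clip μ (v t))) (Icc 0 τ) t := by
  set g : E d → E d := fun x => -(a • F x + m • clip μ x) with hg
  obtain ⟨Kg, hKg⟩ : ∃ Kg, LipschitzWith Kg g :=
    ⟨_, ((((lipschitzWith_smul a).comp hF).add
      ((lipschitzWith_smul m).comp (lipschitzWith_clip hμ))).neg)⟩
  -- `B` bounds the field at `x₀` for every `μ`, and `L` bounds it on the ball of radius `R`. As `a
  -- K τ ≤ 1/2`, one gets `L τ ≤ R/2 + B τ = R`. The Lipschitz constant `Kg` depends on `μ` but does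
  -- not restrict `τ`.
  set B : ℝ := a * ‖F x₀‖ + m * Real.sqrt d with hB
  have hB0 : 0 ≤ B := by positivity
  set R : ℝ := 2 * B * τ with hR
  have hR0 : 0 ≤ R := by positivity
  set L : ℝ := a * K * R + B with hL
  have hL0 : 0 ≤ L := by positivity
  have hpl : IsPicardLindelof (fun _ => g) (⟨0, left_mem_Icc.2 hτ⟩ : Icc (0 : ℝ) τ) x₀
      ⟨R, hR0⟩ 0 ⟨L, hL0⟩ Kg := by
    refine IsPicardLindelof.of_time_independent (fun x hx => ?_) hKg.lipschitzOnWith ?_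
    · change ‖g x‖ ≤ L
      have hx' : ‖x - x₀‖ ≤ R := by
        rw [← dist_eq_norm]; exact hx
      have h1 := hF.norm_sub_le x x₀
      have h2 := norm_sub_norm_le (F x) (F x₀)
      have h3 : ‖F x‖ ≤ K * R + ‖F x₀‖ := by
        have : (K : ℝ) * ‖x - x₀‖ ≤ K * R := by gcongr
        linarith
      rw [hg]
      simp only [norm_neg]
      refine (norm_add_le _ _).trans ?_
      rw [norm_smul, norm_smul, Real.norm_of_nonneg ha, Real.norm_of_nonneg hm]
      have h4 := mul_le_mul_of_nonneg_left h3 ha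
      have h5 := mul_le_mul_of_nonneg_left (norm_clip_le μ x) hm
      rw [hL, hB]
      linarith
    · change L * max (τ - 0) (0 - 0) ≤ R - 0
      rw [sub_zero, sub_zero, sub_zero, max_eq_left hτ, hL]
      have := mul_le_mul_of_nonneg_right haτ hR0
      rw [hR] at *
      linarith
  exact hpl.exists_eq_forall_mem_Icc_hasDerivWithinAt₀

end Regularization

end SparseInversion

namespace SparseInversion

variable {d : ℕ}

/-! ### Passage to the limit in the regularized flows. -/

section OneStep

theorem continuous_clip_apply {μ : ℝ} (hμ : 0 < μ) (i : Fin d) :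
    Continuous fun x : E d => clip μ x i :=
  (EuclideanSpace.proj (𝕜 := ℝ) i).continuous.comp (lipschitzWith_clip hμ).continuous

theorem tendsto_clip_apply_of_pos {μ : ℕ → ℝ} (hμ : ∀ n, 0 < μ n) (hμ0 : Tendsto μ atTop (𝓝 0))
    {x : ℕ → E d} {y : E d} (hx : Tendsto x atTop (𝓝 y)) {i : Fin d} (hy : 0 < y i) :
    Tendsto (fun n => clip (μ n) (x n) i) atTop (𝓝 1) := by
  have h1 : Tendsto (fun n => x n i - μ n) atTop (𝓝 (y i - 0)) :=
    (((EuclideanSpace.proj (𝕜 := ℝ) i).continuous.tendsto y).comp hx).sub hμ0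
  rw [sub_zero] at h1
  refine tendsto_const_nhds.congr' ?_
  filter_upwards [h1.eventually (lt_mem_nhds hy)] with n hn
  rw [clip_apply_of_le (hμ n) (by linarith)]

theorem tendsto_clip_apply_of_neg {μ : ℕ → ℝ} (hμ : ∀ n, 0 < μ n) (hμ0 : Tendsto μ atTop (𝓝 0))
    {x : ℕ → E d} {y : E d} (hx : Tendsto x atTop (𝓝 y)) {i : Fin d} (hy : y i < 0) :
    Tendsto (fun n => clip (μ n) (x n) i) atTop (𝓝 (-1)) := by
  have h1 : Tendsto (fun n => x n i + μ n) atTop (𝓝 (y i + 0)) :=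
    (((EuclideanSpace.proj (𝕜 := ℝ) i).continuous.tendsto y).comp hx).add hμ0
  rw [add_zero] at h1
  refine tendsto_const_nhds.congr' ?_
  filter_upwards [h1.eventually (gt_mem_nhds hy)] with n hn
  rw [clip_apply_of_le_neg (hμ n) (by linarith)]

/-- A pointwise limit of regularized flows solves the inclusion wherever it is differentiable. -/
theorem flowAt_of_tendsto_regularized {F : E d → E d} {K : ℝ≥0} (hF : LipschitzWith K F)
    {a m τ R : ℝ} (hm : 0 ≤ m) {μ : ℕ → ℝ} (hμ : ∀ n, 0 < μ n) (hμ0 : Tendsto μ atTop (𝓝 0))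
    {V : ℕ → ℝ → E d} {v : ℝ → E d}
    (hV : ∀ n, ∀ t ∈ Icc 0 τ,
      HasDerivWithinAt (V n) (-(a • F (V n t) + m • clip (μ n) (V n t))) (Icc 0 τ) t)
    (hR : ∀ n, ∀ t ∈ Icc 0 τ, ‖V n t‖ ≤ R)
    (hlim : ∀ t ∈ Icc 0 τ, Tendsto (fun n => V n t) atTop (𝓝 (v t)))
    (hv : ContinuousOn v (Icc 0 τ)) {t : ℝ} (ht : t ∈ Ioo 0 τ) {w : E d} (hw : HasDerivAt v w t) :
    FlowAt F a m v t := by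
  have hproj : ∀ (i : Fin d), Continuous fun x : E d => x i :=
    fun i => (EuclideanSpace.proj (𝕜 := ℝ) i).continuous
  have hFi : ∀ i, Continuous fun x : E d => F x i := fun i => (hproj i).comp hF.continuous
  have hVc : ∀ n, ContinuousOn (V n) (Icc 0 τ) := fun n r hr => (hV n r hr).continuousWithinAt
  have hint : ∀ {f : ℝ → E d} {g : E d → ℝ}, ContinuousOn f (Icc 0 τ) → Continuous g →
      ∀ r ∈ Icc 0 τ, ∀ s ∈ Icc 0 τ, IntervalIntegrable (fun x => g (f x)) volume r s := by
    intro f g hf hg r hr s hs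
    refine ContinuousOn.intervalIntegrable ((hg.comp_continuousOn hf).mono ?_)
    exact (convex_Icc (0 : ℝ) τ).ordConnected.uIcc_subset hr hs
  -- Up to an additive constant, `q i` is the limit of the primitives of `m clip`. Its derivative at
  -- `t` is the candidate for `m η i`: it is at most `m` in modulus since `q i` is `m`-Lipschitz,
  -- and it equals `±m` where `v t i ≠ 0`, since there `clip` is eventually constant near `t`.
  set q : Fin d → ℝ → ℝ := fun i s => -(v s i) - a * ∫ r in (0 : ℝ)..s, F (v r) i with hq
  have h0 : (0 : ℝ) ∈ Icc 0 τ := ⟨le_rfl, ht.1.le.trans ht.2.le⟩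
  have hqlim : ∀ i, ∀ r ∈ Icc 0 τ, ∀ s ∈ Icc 0 τ, r ≤ s →
      Tendsto (fun n => m * ∫ x in r..s, clip (μ n) (V n x) i) atTop (𝓝 (q i s - q i r)) := by
    intro i r hr s hs hrs
    have hsub : Icc r s ⊆ Icc 0 τ := Icc_subset_Icc hr.1 hs.2
    have h1 : ∀ n, m * ∫ x in r..s, clip (μ n) (V n x) i =
        -(V n s i) + V n r i - a * ∫ x in r..s, F (V n x) i := by
      intro n
      have hi1 := hint (hVc n) (hFi i) r hr s hs
      have hi2 := hint (hVc n) (continuous_clip_apply (hμ n) i) r hr s hs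
      have h2 := intervalIntegral.integral_eq_sub_of_hasDerivAt_of_le hrs
        (f := fun x => V n x i) (f' := fun x => -(a * F (V n x) i + m * clip (μ n) (V n x) i))
        ((hproj i).comp_continuousOn ((hVc n).mono hsub))
        (fun x hx => by
          have hx' := (hV n x (hsub (Ioo_subset_Icc_self hx))).hasDerivAt
            (Icc_mem_nhds (hr.1.trans_lt hx.1) (hx.2.trans_le hs.2))
          exact (EuclideanSpace.proj (𝕜 := ℝ) i).hasFDerivAt.comp_hasDerivAt x hx')
        ((hi1.const_mul a).add (hi2.const_mul m)).neg
      rw [intervalIntegral.integral_neg, intervalIntegral.integral_add (hi1.const_mul a)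
        (hi2.const_mul m), intervalIntegral.integral_const_mul,
        intervalIntegral.integral_const_mul] at h2
      linarith
    have h2 : q i s - q i r = -(v s i) + v r i - a * ∫ x in r..s, F (v x) i := by
      have h3 := intervalIntegral.integral_interval_sub_left
        (hint hv (hFi i) 0 h0 s hs) (hint hv (hFi i) 0 h0 r hr)
      rw [← h3, hq]
      ring
    rw [h2]
    simp only [h1]
    refine (((((hproj i).tendsto _).comp (hlim s hs)).neg).add
      (((hproj i).tendsto _).comp (hlim r hr))).sub (Tendsto.const_mul a ?_)
    refine intervalIntegral.tendsto_integral_filter_of_dominated_convergence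
      (fun _ => K * R + ‖F 0‖) ?_ ?_ ?_ ?_
    · refine Eventually.of_forall fun n => ?_
      have := (hint (hVc n) (hFi i) r hr s hs).aestronglyMeasurable
      rwa [uIoc_of_le hrs]
    · refine Eventually.of_forall fun n => Eventually.of_forall fun x hx => ?_
      rw [uIoc_of_le hrs] at hx
      refine (PiLp.norm_apply_le (F (V n x)) i).trans ((norm_le_of_lipschitzWith hF _).trans ?_)
      have := hR n x (hsub (Ioc_subset_Icc_self hx))
      gcongr
    · exact intervalIntegrable_const
    · refine Eventually.of_forall fun x hx => ?_
      rw [uIoc_of_le hrs] at hx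
      exact ((hFi i).tendsto _).comp (hlim x (hsub (Ioc_subset_Icc_self hx)))
  have hqlip : ∀ i, ∀ r ∈ Icc 0 τ, ∀ s ∈ Icc 0 τ, r ≤ s → |q i s - q i r| ≤ m * (s - r) := by
    intro i r hr s hs hrs
    refine le_of_tendsto (hqlim i r hr s hs hrs).abs (Eventually.of_forall fun n => ?_)
    rw [abs_mul, abs_of_nonneg hm]
    refine mul_le_mul_of_nonneg_left ?_ hm
    have h1 := intervalIntegral.norm_integral_le_of_norm_le_const (a := r) (b := s) (C := 1)
      (f := fun x => clip (μ n) (V n x) i) (fun x _ => abs_clip_le_one _ _ _)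
    rwa [one_mul, abs_of_nonneg (sub_nonneg.2 hrs)] at h1
  have hqeq : ∀ i, ∀ σ : ℝ, ∀ r ∈ Icc 0 τ, ∀ s ∈ Icc 0 τ, r ≤ s →
      (∀ x ∈ Icc r s, Tendsto (fun n => clip (μ n) (V n x) i) atTop (𝓝 σ)) →
      q i s - q i r = m * ((s - r) * σ) := by
    intro i σ r hr s hs hrs hx
    refine tendsto_nhds_unique (hqlim i r hr s hs hrs) (Tendsto.const_mul m ?_)
    have h1 : (s - r) * σ = ∫ _x in r..s, σ := by simp
    rw [h1]
    refine intervalIntegral.tendsto_integral_filter_of_dominated_convergence (fun _ => 1)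
      ?_ ?_ ?_ ?_
    · refine Eventually.of_forall fun n => ?_
      have := (hint (hVc n) (continuous_clip_apply (hμ n) i) r hr s hs).aestronglyMeasurable
      rwa [uIoc_of_le hrs]
    · exact Eventually.of_forall fun n => Eventually.of_forall fun x _ => abs_clip_le_one _ _ _
    · exact intervalIntegrable_const
    · refine Eventually.of_forall fun x hx' => ?_
      rw [uIoc_of_le hrs] at hx'
      exact hx x (Ioc_subset_Icc_self hx')
  have htI : t ∈ Icc 0 τ := Ioo_subset_Icc_self ht
  have hnhds : Icc 0 τ ∈ 𝓝 t := Icc_mem_nhds ht.1 ht.2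
  have hqd : ∀ i, HasDerivAt (q i) (-(w i) - a * F (v t) i) t := by
    intro i
    have h1 : HasDerivAt (fun s => v s i) (w i) t :=
      (EuclideanSpace.proj (𝕜 := ℝ) i).hasFDerivAt.comp_hasDerivAt t hw
    refine h1.neg.sub (HasDerivAt.const_mul a ?_)
    have h2 : ContinuousOn (fun x => F (v x) i) (Ioo 0 τ) :=
      (hFi i).comp_continuousOn (hv.mono Ioo_subset_Icc_self)
    exact intervalIntegral.integral_hasDerivAt_right (hint hv (hFi i) 0 h0 t htI)
      (h2.stronglyMeasurableAtFilter isOpen_Ioo t ht) (h2.continuousAt (Ioo_mem_nhds ht.1 ht.2))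
  have hbound : ∀ i, |-(w i) - a * F (v t) i| ≤ m := by
    intro i
    refine (hqd i).le_of_lip' hm ?_
    filter_upwards [hnhds] with s hs
    rw [Real.norm_eq_abs, Real.norm_eq_abs]
    rcases le_total t s with h | h
    · rw [abs_of_nonneg (sub_nonneg.2 h)]
      exact hqlip i t htI s hs h
    · rw [abs_sub_comm, abs_sub_comm s, abs_of_nonneg (sub_nonneg.2 h)]
      exact hqlip i s hs t htI h
  have hval : ∀ i, ∀ σ : ℝ, (∀ᶠ x in 𝓝 t, Tendsto (fun n => clip (μ n) (V n x) i) atTop (𝓝 σ)) →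
      -(w i) - a * F (v t) i = m * σ := by
    intro i σ hσ
    have h1 : ∀ᶠ s in 𝓝 t, q i s = q i t + m * ((s - t) * σ) := by
      obtain ⟨ρ, hρ, hball⟩ := Metric.eventually_nhds_iff_ball.1 hσ
      filter_upwards [hnhds, Metric.ball_mem_nhds t hρ] with s hs hsb
      have hball' : ∀ x ∈ uIcc t s, Tendsto (fun n => clip (μ n) (V n x) i) atTop (𝓝 σ) :=
        fun x hx => hball x ((convex_ball t ρ).ordConnected.uIcc_subset
          (Metric.mem_ball_self hρ) hsb hx)
      rcases le_total t s with h | h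
      · rw [uIcc_of_le h] at hball'
        have := hqeq i σ t htI s hs h hball'
        linarith
      · rw [uIcc_of_ge h] at hball'
        have := hqeq i σ s hs t htI h hball'
        linarith
    have h2 : HasDerivAt (fun s => q i t + m * ((s - t) * σ)) (m * (1 * σ)) t :=
      ((((hasDerivAt_id t).sub_const t).mul_const σ).const_mul m).const_add _
    have h3 := (hqd i).unique (h2.congr_of_eventuallyEq h1)
    rwa [one_mul] at h3
  have hvi : ∀ i, ContinuousAt (fun x => v x i) t := fun i =>
    (hproj i).continuousAt.comp (hv.continuousAt hnhds)
  have hpos : ∀ i, 0 < v t i → -(w i) - a * F (v t) i = m * 1 := by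
    intro i hi
    refine hval i 1 ?_
    filter_upwards [hnhds, (hvi i).eventually (lt_mem_nhds hi)] with x hx hxi
    exact tendsto_clip_apply_of_pos hμ hμ0 (hlim x hx) hxi
  have hneg : ∀ i, v t i < 0 → -(w i) - a * F (v t) i = m * (-1) := by
    intro i hi
    refine hval i (-1) ?_
    filter_upwards [hnhds, (hvi i).eventually (gt_mem_nhds hi)] with x hx hxi
    exact tendsto_clip_apply_of_neg hμ hμ0 (hlim x hx) hxi
  refine ⟨w, hw, ?_⟩
  -- For `m = 0` one cannot divide by `m`, but then the bound forces `-w = a F(v t)` and any element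
  -- of `Θ` serves.
  rcases hm.eq_or_lt with h | h
  · obtain ⟨η, hη⟩ := signSet_nonempty (v t)
    refine ⟨η, hη, ?_⟩
    ext i
    have h1 := hbound i
    rw [← h] at h1
    have h2 := abs_nonpos_iff.1 h1
    simp only [← h, zero_smul, add_zero, PiLp.neg_apply, PiLp.smul_apply, smul_eq_mul]
    linarith
  · refine ⟨WithLp.toLp 2 fun i => (-(w i) - a * F (v t) i) / m, fun i => ⟨fun hi => ?_,
      fun _ => ?_, fun hi => ?_⟩, ?_⟩
    · change (-(w i) - a * F (v t) i) / m = 1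
      rw [hpos i hi, mul_div_cancel_left₀ _ h.ne']
    · change (-(w i) - a * F (v t) i) / m ∈ Icc (-1 : ℝ) 1
      have h1 := abs_le.1 (hbound i)
      exact ⟨(le_div_iff₀ h).2 (by linarith), (div_le_iff₀ h).2 (by linarith)⟩
    · change (-(w i) - a * F (v t) i) / m = -1
      rw [hneg i hi, mul_div_cancel_left₀ _ h.ne']
    · ext i
      change -(w i) = a * F (v t) i + m * ((-(w i) - a * F (v t) i) / m)
      rw [mul_div_cancel₀ _ h.ne']
      ring

end OneStep

end SparseInversion

/-! ### Lipschitz curves on intervals. -/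

section Lipschitz

theorem lipschitzOnWith_of_forall_le {V : Type*} [NormedAddCommGroup V] {v : ℝ → V} {S : Set ℝ}
    {L : ℝ} (hL : 0 ≤ L) (h : ∀ s ∈ S, ∀ t ∈ S, s ≤ t → ‖v t - v s‖ ≤ L * (t - s)) :
    LipschitzOnWith (Real.toNNReal L) v S := by
  refine LipschitzOnWith.of_dist_le_mul fun x hx y hy => ?_
  rw [Real.coe_toNNReal _ hL]
  rcases le_total x y with hxy | hxy
  · rw [dist_comm, dist_comm x, dist_eq_norm, Real.dist_eq, abs_of_nonneg (sub_nonneg.2 hxy)]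
    exact h x hx y hy hxy
  · rw [dist_eq_norm, Real.dist_eq, abs_of_nonneg (sub_nonneg.2 hxy)]
    exact h y hy x hx hxy

theorem LipschitzOnWith.Icc_union {X : Type*} [PseudoMetricSpace X] {f : ℝ → X} {K K' : ℝ≥0}
    {a b c : ℝ} (h : LipschitzOnWith K f (Icc a b)) (h' : LipschitzOnWith K' f (Icc b c)) :
    LipschitzOnWith (max K K') f (Icc a c) := by
  have h1 := h.weaken (le_max_left K K')
  have h2 := h'.weaken (le_max_right K K')
  have key : ∀ x ∈ Icc a c, ∀ y ∈ Icc a c, x ≤ y →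
      dist (f x) (f y) ≤ (max K K' : ℝ≥0) * dist x y := by
    intro x hx y hy hxy
    rcases le_total y b with hyb | hyb
    · exact h1.dist_le_mul x ⟨hx.1, hxy.trans hyb⟩ y ⟨hy.1, hyb⟩
    rcases le_total b x with hxb | hxb
    · exact h2.dist_le_mul x ⟨hxb, hx.2⟩ y ⟨hyb, hy.2⟩
    · have h3 := h1.dist_le_mul x ⟨hx.1, hxb⟩ b ⟨hx.1.trans hxb, le_rfl⟩
      have h4 := h2.dist_le_mul b ⟨le_rfl, hyb.trans hy.2⟩ y ⟨hyb, hy.2⟩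
      refine (dist_triangle _ (f b) _).trans ((add_le_add h3 h4).trans ?_)
      rw [← mul_add, Real.dist_eq, Real.dist_eq, Real.dist_eq, abs_of_nonpos (sub_nonpos.2 hxb),
        abs_of_nonpos (sub_nonpos.2 hyb), abs_of_nonpos (sub_nonpos.2 hxy)]
      apply le_of_eq
      ring
  refine LipschitzOnWith.of_dist_le_mul fun x hx y hy => ?_
  rcases le_total x y with hxy | hxy
  · exact key x hx y hy hxy
  · rw [dist_comm, dist_comm x]
    exact key y hy x hx hxy

theorem absolutelyContinuousOnInterval_of_hasDerivWithinAt {V : Type*} [NormedAddCommGroup V]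
    [NormedSpace ℝ V] {g : V → V} (hg : Continuous g) {v : ℝ → V} {a b : ℝ} (hab : a ≤ b)
    (h : ∀ t ∈ Icc a b, HasDerivWithinAt v (g (v t)) (Icc a b) t) :
    AbsolutelyContinuousOnInterval v a b := by
  have hc : ContinuousOn (fun t => g (v t)) (Icc a b) :=
    hg.comp_continuousOn fun t ht => (h t ht).continuousWithinAt
  obtain ⟨C, hC⟩ := isCompact_Icc.exists_bound_of_continuousOn hc
  have hC0 : 0 ≤ C := (norm_nonneg _).trans (hC a ⟨le_rfl, hab⟩)
  refine LipschitzOnWith.absolutelyContinuousOnInterval (K := Real.toNNReal C) ?_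
  rw [uIcc_of_le hab]
  refine (convex_Icc a b).lipschitzOnWith_of_nnnorm_hasDerivWithin_le h fun t ht => ?_
  rw [← NNReal.coe_le_coe, Real.coe_toNNReal _ hC0]
  exact hC t ht

end Lipschitz

namespace SparseInversion

variable {d : ℕ}

/-! ### Existence for constant and for piecewise constant coefficients. -/

section Existence

variable {F : E d → E d} {K : ℝ≥0}

theorem IsFlowOn.exists_lipschitzOnWith (hF : LipschitzWith K F) (hmon : IsMonotone F)
    {a m : ℝ → ℝ} {M N T : ℝ} {v : ℝ → E d} (ha : ∀ t, 0 ≤ a t ∧ a t ≤ M)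
    (hm : ∀ t, 0 ≤ m t ∧ m t ≤ N) (h : IsFlowOn F a m T v) :
    ∃ L, LipschitzOnWith L v (Icc 0 T) := by
  obtain ⟨R, L, -, hL, hb⟩ := exists_forall_isFlowOn_bounds hF hmon M N T (v 0)
    ((ha 0).1.trans (ha 0).2) ((hm 0).1.trans (hm 0).2)
  exact ⟨_, lipschitzOnWith_of_forall_le hL fun s hs t ht hst =>
    (hb a m v ha hm h rfl).2 s t hs.1 hst ht.2⟩

/-- Existence of the flow with constant coefficients on a short time interval. -/
theorem exists_isFlowOn_const (hF : LipschitzWith K F) (hmon : IsMonotone F) {a m τ : ℝ}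
    (ha : 0 ≤ a) (hm : 0 ≤ m) (hτ : 0 ≤ τ) (haτ : a * K * τ ≤ 1 / 2) (x₀ : E d) :
    ∃ v, v 0 = x₀ ∧ IsFlowOn F (fun _ => a) (fun _ => m) τ v := by
  set μ : ℕ → ℝ := fun n => 1 / ((n : ℝ) + 1) with hμdef
  have hμ : ∀ n, 0 < μ n := fun n => Nat.one_div_pos_of_nat
  have hμ0 : Tendsto μ atTop (𝓝 0) := tendsto_one_div_add_atTop_nhds_zero_nat
  choose V hV0 hV using fun n => exists_regularized_flow hF ha hm (hμ n) hτ haτ x₀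
  have hVac : ∀ n, AbsolutelyContinuousOnInterval (V n) 0 τ := fun n =>
    absolutelyContinuousOnInterval_of_hasDerivWithinAt
      (((hF.continuous.const_smul a).add
        ((lipschitzWith_clip (hμ n)).continuous.const_smul m)).neg) hτ (hV n)
  have hVd : ∀ n, ∀ t ∈ Ioo 0 τ,
      HasDerivAt (V n) (-(a • F (V n t) + m • clip (μ n) (V n t))) t := fun n t ht =>
    (hV n t (Ioo_subset_Icc_self ht)).hasDerivAt (Icc_mem_nhds ht.1 ht.2)
  obtain ⟨R, L, -, hL, hb⟩ := exists_forall_norm_le_and_lipschitz hF hmon a m τ x₀ ha hm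
  have hVb := fun n => hb (fun _ => a) (fun _ => m) (V n) (fun _ => ⟨ha, le_rfl⟩)
    (fun _ => ⟨hm, le_rfl⟩) (hVac n) (Eventually.of_forall fun t ht =>
      ⟨_, hVd n t ht, clip (μ n) (V n t), norm_clip_le _ _, inner_clip_nonneg (hμ n) _,
        neg_neg _⟩) (hV0 n)
  -- The factor is `2 m` times the monotonicity defect `2 d (μ n + μ k)` of the regularized sign
  -- maps.
  have hdist : ∀ n k, ∀ t ∈ Icc 0 τ,
      ‖V n t - V k t‖ ^ 2 ≤ 4 * m * d * (μ n + μ k) * t := by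
    intro n k t ht
    set C := 4 * m * d * (μ n + μ k) with hC
    have hsub : uIcc 0 t ⊆ uIcc 0 τ := by
      rw [uIcc_of_le ht.1, uIcc_of_le hτ]; exact Icc_subset_Icc_right ht.2
    have h1 : AbsolutelyContinuousOnInterval (fun s => ‖V n s - V k s‖ ^ 2 - C * s) 0 t :=
      (((hVac n).fun_sub (hVac k)).norm_sq.mono hsub).fun_sub
        (ContDiffOn.absolutelyContinuousOnInterval (by fun_prop))
    have h2 := h1.le_of_ae_deriv_nonpos ht.1 (Eventually.of_forall fun s hs => by
      have hs' : s ∈ Ioo 0 τ := ⟨hs.1, hs.2.trans_le ht.2⟩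
      refine ⟨_, ((hVd n s hs').fun_sub (hVd k s hs')).norm_sq.sub
        ((hasDerivAt_id s).const_mul C), ?_⟩
      have h3 : -(a • F (V n s) + m • clip (μ n) (V n s)) -
          -(a • F (V k s) + m • clip (μ k) (V k s)) =
          -(a • (F (V n s) - F (V k s)) + m • (clip (μ n) (V n s) - clip (μ k) (V k s))) := by
        module
      have h4 := mul_nonneg ha (hmon (V n s) (V k s))
      have h5 := mul_le_mul_of_nonneg_left
        (neg_le_inner_clip_sub_clip (hμ n) (hμ k) (V n s) (V k s)) hm
      rw [h3, real_inner_comm, inner_neg_left, inner_add_left, real_inner_smul_left,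
        real_inner_smul_left, hC]
      linarith)
    simp only [hV0, sub_self, norm_zero, mul_zero] at h2
    linarith
  have hcauchy : ∀ t ∈ Icc 0 τ, CauchySeq fun n => V n t := by
    intro t ht
    refine cauchySeq_of_le_tendsto_0 (fun n => Real.sqrt (8 * m * d * τ * μ n)) ?_ ?_
    · intro n k N hn hk
      rw [dist_eq_norm]
      refine Real.le_sqrt_of_sq_le ((hdist n k t ht).trans ?_)
      have h1 : μ n ≤ μ N := Nat.one_div_le_one_div hn
      have h2 : μ k ≤ μ N := Nat.one_div_le_one_div hk
      have h3 := ht.1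
      have h4 := ht.2
      have h5 : 0 ≤ μ N := (hμ N).le
      calc 4 * m * d * (μ n + μ k) * t ≤ 4 * m * d * (μ N + μ N) * τ := by gcongr
        _ = 8 * m * d * τ * μ N := by ring
    · have := (hμ0.const_mul (8 * m * d * τ)).sqrt
      simpa using this
  have hex : ∀ t, ∃ y, t ∈ Icc 0 τ → Tendsto (fun n => V n t) atTop (𝓝 y) := by
    intro t
    by_cases ht : t ∈ Icc 0 τ
    · obtain ⟨y, hy⟩ := cauchySeq_tendsto_of_complete (hcauchy t ht)
      exact ⟨y, fun _ => hy⟩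
    · exact ⟨0, fun h => absurd h ht⟩
  choose v hv using hex
  have hlip : LipschitzOnWith (Real.toNNReal L) v (Icc 0 τ) :=
    lipschitzOnWith_of_forall_le hL fun s hs t ht hst =>
      le_of_tendsto ((hv t ht).sub (hv s hs)).norm
        (Eventually.of_forall fun n => (hVb n).2 s t hs.1 hst ht.2)
  refine ⟨v, ?_, ?_, ?_⟩
  · refine tendsto_nhds_unique (hv 0 ⟨le_rfl, hτ⟩) ?_
    simp only [hV0]
    exact tendsto_const_nhds
  · exact LipschitzOnWith.absolutelyContinuousOnInterval (by rwa [uIcc_of_le hτ])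
  · have h1 := (ae_restrict_iff' measurableSet_Icc).1
      (hlip.ae_differentiableWithinAt_real measurableSet_Icc)
    filter_upwards [h1] with t ht htI
    exact flowAt_of_tendsto_regularized hF hm hμ hμ0 hV (fun n => (hVb n).1) hv hlip.continuousOn
      htI ((ht (Ioo_subset_Icc_self htI)).differentiableAt
        (Icc_mem_nhds htI.1 htI.2)).hasDerivAt

/-- Existence of the flow whose coefficients are constant on the intervals `[k h, (k + 1) h)`. -/
theorem exists_isFlowOn_piecewise_of_small (hF : LipschitzWith K F) (hmon : IsMonotone F) {h M : ℝ}
    (hh : 0 < h) (hMh : M * K * h ≤ 1 / 2) {α β : ℕ → ℝ} (hα : ∀ k, 0 ≤ α k ∧ α k ≤ M)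
    (hβ : ∀ k, 0 ≤ β k) (x₀ : E d) :
    ∃ v, v 0 = x₀ ∧
      ∀ T, 0 ≤ T → IsFlowOn F (fun t => α ⌊t / h⌋₊) (fun t => β ⌊t / h⌋₊) T v := by
  have hstep : ∀ k x, ∃ v : ℝ → E d, v 0 = x ∧
      IsFlowOn F (fun _ => α k) (fun _ => β k) h v := by
    intro k x
    refine exists_isFlowOn_const hF hmon (hα k).1 (hβ k) hh.le (le_trans ?_ hMh) x
    have := (hα k).2
    gcongr
  choose S hS0 hS using hstep
  let X : ℕ → E d := fun n => Nat.rec x₀ (fun k x => S k x h) n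
  have hX : ∀ k, X (k + 1) = S k (X k) h := fun k => rfl
  set v : ℝ → E d := fun t => S ⌊t / h⌋₊ (X ⌊t / h⌋₊) (t - ⌊t / h⌋₊ * h) with hv
  have hfloor : ∀ (k : ℕ) t, t ∈ Ico (k * h) ((k + 1) * h) → ⌊t / h⌋₊ = k := by
    intro k t ht
    have ht0 : 0 ≤ t := (by positivity : (0 : ℝ) ≤ k * h).trans ht.1
    rw [Nat.floor_eq_iff (by positivity)]
    exact ⟨(le_div_iff₀ hh).2 ht.1, (div_lt_iff₀ hh).2 ht.2⟩
  -- Both endpoints are admitted: at the right one the floor already selects piece `k + 1`, which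
  -- starts where piece `k` ends.
  have hpiece : ∀ (k : ℕ), ∀ t ∈ Icc (k * h) ((k + 1) * h), v t = S k (X k) (t - k * h) := by
    intro k t ht
    rcases ht.2.eq_or_lt with h1 | h1
    · have h2 : ⌊t / h⌋₊ = k + 1 := by
        refine hfloor (k + 1) t ⟨?_, ?_⟩
        · push_cast; exact h1.ge
        · push_cast; rw [h1]; nlinarith
      simp only [hv, h2]
      push_cast
      rw [← h1, sub_self, hS0, hX, h1]
      congr 1
      ring
    · simp only [hv, hfloor k t ⟨ht.1, h1⟩]
  have hlip : ∀ n : ℕ, ∃ L, LipschitzOnWith L v (Icc 0 (n * h)) := by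
    intro n
    induction n with
    | zero => exact ⟨0, by simp [LipschitzOnWith]⟩
    | succ n ih =>
      obtain ⟨L, hL⟩ := ih
      obtain ⟨L', hL'⟩ := (hS n (X n)).exists_lipschitzOnWith hF hmon
        (fun _ => ⟨(hα n).1, le_rfl⟩) (fun _ => ⟨hβ n, le_rfl⟩)
      refine ⟨max L L', hL.Icc_union ?_⟩
      refine LipschitzOnWith.of_dist_le_mul fun x hx y hy => ?_
      push_cast at hx hy
      rw [hpiece n x hx, hpiece n y hy]
      have := hL'.dist_le_mul (x - n * h) ⟨by linarith [hx.1], by linarith [hx.2]⟩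
        (y - n * h) ⟨by linarith [hy.1], by linarith [hy.2]⟩
      rwa [dist_sub_right] at this
  have hae : ∀ᵐ t, ∀ k : ℕ, t ∈ Ioo (k * h) ((k + 1) * h) →
      FlowAt F (α k) (β k) v t := by
    rw [ae_all_iff]
    intro k
    have h1 := (measurePreserving_sub_right volume ((k : ℝ) * h)).quasiMeasurePreserving.ae
      (hS k (X k)).flowAt
    filter_upwards [h1] with t ht htI
    obtain ⟨w, hw, η, hη, hwe⟩ := ht ⟨by linarith [htI.1], by linarith [htI.2]⟩
    have h2 := hpiece k t (Ioo_subset_Icc_self htI)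
    refine ⟨w, ?_, η, by rwa [h2], by rwa [h2]⟩
    refine (hw.comp_sub_const t (k * h)).congr_of_eventuallyEq ?_
    filter_upwards [Ioo_mem_nhds htI.1 htI.2] with s hs
    exact hpiece k s (Ioo_subset_Icc_self hs)
  have hne : ∀ᵐ t : ℝ, ∀ k : ℕ, t ≠ k * h := by
    rw [ae_all_iff]
    intro k
    exact Measure.ae_ne volume _
  refine ⟨v, ?_, fun T hT => ?_⟩
  · have := hpiece 0 0 ⟨by simp, by simp [hh.le]⟩
    rw [this]
    simp [hS0, X]
  · obtain ⟨n, hn⟩ := exists_nat_ge (T / h)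
    have hn' : T ≤ n * h := (div_le_iff₀ hh).1 hn
    refine IsFlowOn.mono (T := n * h) ⟨?_, ?_⟩ hT hn'
    · obtain ⟨L, hL⟩ := hlip n
      exact LipschitzOnWith.absolutelyContinuousOnInterval
        (by rwa [uIcc_of_le (hT.trans hn')])
    · filter_upwards [hae, hne] with t ht hne htI
      have h1 : (⌊t / h⌋₊ : ℝ) ≤ t / h := Nat.floor_le (div_nonneg htI.1.le hh.le)
      have h2 : t / h < ⌊t / h⌋₊ + 1 := Nat.lt_floor_add_one _
      refine ht ⌊t / h⌋₊ ⟨lt_of_le_of_ne ((le_div_iff₀ hh).1 h1) (hne _).symm,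
        (div_lt_iff₀ hh).1 h2⟩

/-- Existence of the flow whose coefficients are constant on the intervals `[k ε, (k + 1) ε)`. -/
theorem exists_isFlowOn_piecewise (hF : LipschitzWith K F) (hmon : IsMonotone F) {ε M : ℝ}
    (hε : 0 < ε) {α β : ℕ → ℝ} (hα : ∀ k, 0 ≤ α k ∧ α k ≤ M) (hβ : ∀ k, 0 ≤ β k) (x₀ : E d) :
    ∃ v, v 0 = x₀ ∧
      ∀ T, 0 ≤ T → IsFlowOn F (fun t => α ⌊t / ε⌋₊) (fun t => β ⌊t / ε⌋₊) T v := by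
  have hM : 0 ≤ M := (hα 0).1.trans (hα 0).2
  -- Each interval of length `ε` is cut into `n` parts short enough for the local existence result;
  -- the part with index `k` lies in the coarse interval with index `k / n`.
  obtain ⟨n, hn⟩ := exists_nat_gt (2 * (M * K * ε))
  have hn0 : (0 : ℝ) < n := lt_of_le_of_lt (by positivity) hn
  obtain ⟨v, hv0, hv⟩ := exists_isFlowOn_piecewise_of_small hF hmon (h := ε / n) (M := M)
    (by positivity) (by
      rw [← mul_div_assoc, div_le_iff₀ hn0]; linarith)
    (α := fun k => α (k / n)) (β := fun k => β (k / n)) (fun k => hα _) (fun k => hβ _) x₀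
  refine ⟨v, hv0, fun T hT => (hv T hT).congr_coeff ?_ ?_⟩ <;>
  · intro t ht
    rw [← Nat.floor_div_natCast, div_div, div_mul_cancel₀ _ hn0.ne']

end Existence

end SparseInversion

namespace SparseInversion

variable {d : ℕ} {F : E d → E d} {K : ℝ≥0}

/-! ### One-step comparison with the averaged flow. -/

section Comparison

/-- One time step of a flow with coefficients `α`, `β lam` compared with the flow with coefficients
`1`, `lam`. -/
theorem norm_sub_sq_le_of_step (hF : Continuous F) (hmon : IsMonotone F) {a m : ℝ → ℝ}
    {lam T α β L B G : ℝ} {u v : ℝ → E d} (hlam : 0 ≤ lam) (hα : 0 ≤ α) (hβ : 0 ≤ β)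
    (hu : IsFlowOn F (fun _ => 1) (fun _ => lam) T u) (hv : IsFlowOn F a m T v)
    {s t : ℝ} (hs : 0 ≤ s) (hst : s ≤ t) (ht : t ≤ T)
    (ha : ∀ r ∈ Ioo s t, a r = α) (hm : ∀ r ∈ Ioo s t, m r = β * lam)
    (huL : ∀ r ∈ Icc s t, ‖u r - u s‖ ≤ L * (r - s))
    (hvL : ∀ r ∈ Icc s t, ‖v r - v s‖ ≤ L * (r - s))
    (hB : ∀ r ∈ Icc s t, ‖F (u r)‖ ≤ B)
    (hG : |1 - α| * B + |1 - β| * (lam * Real.sqrt d) ≤ G) :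
    ‖v t - u t‖ ^ 2 ≤ ‖v s - u s‖ ^ 2
      + 2 * ((1 - α) * ∫ r in s..t, ⟪v s - u s, F (u r)⟫)
      + 2 * ((β - 1) * (⟪v s - u s, u t - u s⟫ + ∫ r in s..t, ⟪v s - u s, F (u r)⟫))
      + 2 * G * L * (t - s) ^ 2 := by
  set D := v s - u s with hD
  have huac := hu.absolutelyContinuous_Icc hs hst ht
  have hvac := hv.absolutelyContinuous_Icc hs hst ht
  have hint : IntervalIntegrable (fun r => ⟪D, F (u r)⟫) volume s t := by
    refine ContinuousOn.intervalIntegrable ?_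
    exact ((innerSL ℝ D).continuous.comp hF).comp_continuousOn huac.continuousOn
  set J : ℝ → ℝ := fun r => ∫ x in s..r, ⟪D, F (u x)⟫ with hJ
  have hJac : AbsolutelyContinuousOnInterval J s t :=
    hint.absolutelyContinuousOnInterval_intervalIntegral left_mem_uIcc
  -- The selection `η` along `u` is not known to be measurable, so it is never integrated: by the
  -- equation for `u`, `lam ⟪D, η⟫ = -⟪D, u'⟫ - ⟪D, F u⟫`, which has the primitive `-(⟪D, u⟫ + J)`.
  -- The quadratic term is the integral of `4 G L (r - s)`, the cost of freezing `v - u` at `D`.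
  have hac : AbsolutelyContinuousOnInterval
      (fun r => ‖v r - u r‖ ^ 2 - 2 * (1 - α) * J r - 2 * (β - 1) * (⟪D, u r⟫ + J r)
        - 2 * G * L * (r - s) ^ 2) s t :=
    (((hvac.fun_sub huac).norm_sq.fun_sub (hJac.const_mul (2 * (1 - α)))).fun_sub
      (((huac.inner_const D).fun_add hJac).const_mul (2 * (β - 1)))).fun_sub
      (ContDiffOn.absolutelyContinuousOnInterval (by fun_prop))
  have key := hac.le_of_ae_deriv_nonpos hst (by
    filter_upwards [hv.ae_flowAt_Ioo hs ht, hu.ae_flowAt_Ioo hs ht,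
      hint.ae_hasDerivAt_integral] with r hvr hur hJr hr
    have hrI : r ∈ Icc s t := Ioo_subset_Icc_self hr
    obtain ⟨p, hp, ζ, hζ, hpe⟩ := hvr hr
    obtain ⟨q, hq, η, hη, hqe⟩ := hur hr
    rw [ha r hr, hm r hr] at hpe
    rw [one_smul] at hqe
    have hJd : HasDerivAt J ⟪D, F (u r)⟫ r :=
      hJr (by rwa [uIcc_of_le hst]) s left_mem_uIcc
    have hDu : HasDerivAt (fun r => ⟪D, u r⟫) ⟪D, q⟫ r :=
      (innerSL ℝ D).hasFDerivAt.comp_hasDerivAt r hq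
    refine ⟨_, (((hp.fun_sub hq).norm_sq.sub (hJd.const_mul (2 * (1 - α)))).sub
      ((hDu.add hJd).const_mul (2 * (β - 1)))).sub
      ((((hasDerivAt_id r).sub_const s).pow 2).const_mul (2 * G * L)), ?_⟩
    -- `g` is the deviation of the current rates from their mean, evaluated along `u`; the rest of
    -- `p - q` is dissipative.
    set g := (1 - α) • F (u r) + ((1 - β) * lam) • η with hg
    have hp' : p = -(α • F (v r) + (β * lam) • ζ) := by rw [← hpe, neg_neg]
    have hq' : q = -(F (u r) + lam • η) := by rw [← hqe, neg_neg]
    have hpq : p - q = -(α • (F (v r) - F (u r)) + (β * lam) • (ζ - η)) + g := by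
      rw [hp', hq', hg]; module
    have h1 := mul_nonneg hα (hmon (v r) (u r))
    have h2 := mul_nonneg (mul_nonneg hβ hlam) (signSet_monotone hζ hη)
    have h3 : ⟪D, q⟫ = -(⟪D, F (u r)⟫ + lam * ⟪D, η⟫) := by
      rw [hq', inner_neg_right, inner_add_right, real_inner_smul_right]
    have h4 : ⟪D, g⟫ = (1 - α) * ⟪D, F (u r)⟫ + (1 - β) * lam * ⟪D, η⟫ := by
      rw [hg, inner_add_right, real_inner_smul_right, real_inner_smul_right]
    have h5 : ⟪v r - u r, p - q⟫ = -(α * ⟪F (v r) - F (u r), v r - u r⟫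
        + β * lam * ⟪ζ - η, v r - u r⟫) + ⟪v r - u r, g⟫ := by
      rw [hpq, inner_add_right, inner_neg_right, inner_add_right, real_inner_smul_right,
        real_inner_smul_right, real_inner_comm (v r - u r) (F (v r) - F (u r)),
        real_inner_comm (v r - u r) (ζ - η)]
    have h6 : ⟪v r - u r, g⟫ - ⟪D, g⟫ ≤ 2 * L * (r - s) * G := by
      rw [← inner_sub_left]
      refine (real_inner_le_norm _ _).trans ?_
      have h7 : ‖v r - u r - D‖ ≤ 2 * L * (r - s) := by
        have : v r - u r - D = (v r - v s) - (u r - u s) := by rw [hD]; abel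
        rw [this]
        refine (norm_sub_le _ _).trans ?_
        linarith [huL r hrI, hvL r hrI]
      have h8 : ‖g‖ ≤ G := by
        refine le_trans ?_ hG
        refine (norm_add_le _ _).trans ?_
        rw [norm_smul, norm_smul, Real.norm_eq_abs, Real.norm_eq_abs, abs_mul, abs_of_nonneg hlam,
          mul_assoc]
        have := hB r hrI
        have := norm_le_of_mem_signSet hη
        gcongr
      exact mul_le_mul h7 h8 (norm_nonneg _) ((norm_nonneg _).trans h7)
    rw [h5, h3]
    rw [h4] at h6
    simp only [id, Nat.cast_ofNat, Nat.add_one_sub_one, pow_one]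
    linarith)
  have hJs : J s = 0 := intervalIntegral.integral_same
  rw [hJs] at key
  rw [inner_sub_right]
  simp only [sub_self, ne_eq, OfNat.ofNat_ne_zero, not_false_eq_true, zero_pow] at key
  change _ ≤ _ + 2 * ((1 - α) * J t) + 2 * ((β - 1) * (⟪D, u t⟫ - ⟪D, u s⟫ + J t)) + _
  linarith

end Comparison

/-! ### Random rates, dependence on finitely many choices, independence. -/

section Random

/-- The relative rate of the least-squares flow for the choice of a batch. -/
noncomputable def lsRate (π₁ : ℝ) (i : Fin 2) : ℝ := if i = 0 then 1 / π₁ else 0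

/-- The relative rate of the shrinking flow for the choice of a batch. -/
noncomputable def shrinkRate (π₂ : ℝ) (i : Fin 2) : ℝ := if i = 1 then 1 / π₂ else 0

theorem lsRate_nonneg {π₁ : ℝ} (h : 0 < π₁) (i : Fin 2) : 0 ≤ lsRate π₁ i := by
  unfold lsRate; split_ifs <;> positivity

theorem lsRate_le {π₁ : ℝ} (h : 0 < π₁) (i : Fin 2) : lsRate π₁ i ≤ 1 + 1 / π₁ := by
  have : 0 < 1 / π₁ := by positivity
  unfold lsRate; split_ifs <;> linarith

theorem shrinkRate_nonneg {π₂ : ℝ} (h : 0 < π₂) (i : Fin 2) : 0 ≤ shrinkRate π₂ i := by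
  unfold shrinkRate; split_ifs <;> positivity

theorem shrinkRate_le {π₂ : ℝ} (h : 0 < π₂) (i : Fin 2) : shrinkRate π₂ i ≤ 1 + 1 / π₂ := by
  have : 0 < 1 / π₂ := by positivity
  unfold shrinkRate; split_ifs <;> linarith

/-- A choice of flows for every realization of the batches. -/
def IsFlowFamily (F : E d → E d) (lam π₁ π₂ : ℝ) (u₀ : E d) (ε : ℝ)
    (V : (ℕ → Fin 2) → ℝ → E d) : Prop :=
  ∀ σ, V σ 0 = u₀ ∧ ∀ T, 0 ≤ T → IsFlowOn F (fun t => lsRate π₁ (σ ⌊t / ε⌋₊))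
    (fun t => shrinkRate π₂ (σ ⌊t / ε⌋₊) * lam) T (V σ)

variable {lam π₁ π₂ ε : ℝ} {u₀ : E d} {V : (ℕ → Fin 2) → ℝ → E d}

theorem exists_isFlowFamily (hF : LipschitzWith K F) (hmon : IsMonotone F) (hlam : 0 ≤ lam)
    (hπ₁ : 0 < π₁) (hπ₂ : 0 < π₂) (u₀ : E d) (hε : 0 < ε) :
    ∃ V, IsFlowFamily F lam π₁ π₂ u₀ ε V := by
  choose V hV using fun σ : ℕ → Fin 2 => exists_isFlowOn_piecewise hF hmon hε (M := 1 + 1 / π₁)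
    (α := fun k => lsRate π₁ (σ k)) (β := fun k => shrinkRate π₂ (σ k) * lam)
    (fun k => ⟨lsRate_nonneg hπ₁ _, lsRate_le hπ₁ _⟩)
    (fun k => mul_nonneg (shrinkRate_nonneg hπ₂ _) hlam) u₀
  exact ⟨V, hV⟩

/-- The first `n` choices of a sequence, continued by zero. -/
def extendChoice (n : ℕ) (τ : Finset.range n → Fin 2) (k : ℕ) : Fin 2 :=
  if h : k ∈ Finset.range n then τ ⟨k, h⟩ else 0

/-- Up to time `n ε` the state depends only on the first `n` choices. -/
theorem IsFlowFamily.apply_eq (hV : IsFlowFamily F lam π₁ π₂ u₀ ε V) (hmon : IsMonotone F)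
    (hlam : 0 ≤ lam) (hπ₁ : 0 < π₁) (hπ₂ : 0 < π₂) (hε : 0 < ε) (σ : ℕ → Fin 2) {n : ℕ} {t : ℝ}
    (ht : 0 ≤ t) (htn : t ≤ n * ε) :
    V σ t = V (extendChoice n fun i => σ i) t := by
  have h1 := (hV (extendChoice n fun i => σ i)).2 t ht
  have hk : ∀ r ∈ Ioo 0 t, extendChoice n (fun i => σ i) ⌊r / ε⌋₊ = σ ⌊r / ε⌋₊ := by
    intro r hr
    have h2 : ⌊r / ε⌋₊ < n := by
      rw [Nat.floor_lt (div_nonneg hr.1.le hε.le), div_lt_iff₀ hε]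
      exact hr.2.trans_le htn
    simp [extendChoice, h2]
  refine ((hV σ).2 t ht).eqOn hmon (fun _ => lsRate_nonneg hπ₁ _)
    (fun _ => mul_nonneg (shrinkRate_nonneg hπ₂ _) hlam)
    (h1.congr_coeff (fun r hr => ?_) (fun r hr => ?_)) ?_ ⟨ht, le_rfl⟩
  · rw [hk r hr]
  · rw [hk r hr]
  · rw [(hV σ).1, (hV _).1]

variable {Ω : Type*} [MeasurableSpace Ω] {P : Measure Ω} {j : ℕ → Ω → Fin 2}

/-- The domain of `g` is finite, so no regularity of the flow in the choices is needed;
integrability below is free for the same reason. -/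
theorem measurable_comp_prefix {X : Type*} [MeasurableSpace X] (hj : ∀ k, Measurable (j k)) (n : ℕ)
    (g : (Finset.range n → Fin 2) → X) : Measurable fun ω => g fun i => j i ω :=
  (measurable_of_finite g).comp (measurable_pi_lambda _ fun i => hj i)

theorem integrable_comp_prefix [IsFiniteMeasure P] (hj : ∀ k, Measurable (j k)) (n : ℕ)
    (g : (Finset.range n → Fin 2) → ℝ) : Integrable (fun ω => g fun i => j i ω) P :=
  (Integrable.of_finite (μ := P.map fun ω (i : Finset.range n) => j i ω) (f := g)).comp_measurable
    (measurable_pi_lambda _ fun i => hj i)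

theorem IsBatchSequence.integral_comp [IsProbabilityMeasure P] (hj : IsBatchSequence P π₁ π₂ j)
    (c : Fin 2 → ℝ) (k : ℕ) : ∫ ω, c (j k ω) ∂P = π₁ * c 0 + π₂ * c 1 := by
  have h0 : MeasurableSet {ω | j k ω = 0} := hj.measurable k (measurableSet_singleton 0)
  have h1 : MeasurableSet {ω | j k ω = 1} := hj.measurable k (measurableSet_singleton 1)
  have hc : ∀ ω, c (j k ω) = {ω | j k ω = 0}.indicator (fun _ => c 0) ω
      + {ω | j k ω = 1}.indicator (fun _ => c 1) ω := by
    intro ω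
    rcases Fin.exists_fin_two.1 ⟨j k ω, rfl⟩ with h | h <;> simp [h]
  simp only [hc]
  rw [integral_add ((integrable_const _).indicator h0) ((integrable_const _).indicator h1),
    integral_indicator_const _ h0, integral_indicator_const _ h1, hj.prob_one, hj.prob_two,
    smul_eq_mul, smul_eq_mul]

/-- A centred function of the next choice is orthogonal to the functions of the previous choices. -/
theorem IsBatchSequence.integral_mul_comp_prefix [IsProbabilityMeasure P]
    (hj : IsBatchSequence P π₁ π₂ j) {c : Fin 2 → ℝ} (hc : π₁ * c 0 + π₂ * c 1 = 0) (n : ℕ)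
    (g : (Finset.range n → Fin 2) → ℝ) : ∫ ω, c (j n ω) * g (fun i => j i ω) ∂P = 0 := by
  have h1 := hj.indep.indepFun_finset (Finset.range n) {n} (by simp) hj.measurable
  have h2 : IndepFun (fun ω => c (j n ω)) (fun ω => g fun i => j i ω) P :=
    (h1.comp (φ := g)
      (ψ := fun x : ({n} : Finset ℕ) → Fin 2 => c (x ⟨n, Finset.mem_singleton_self n⟩))
      (measurable_of_finite _) (measurable_of_finite _)).symm
  have h3 := h2.integral_mul_eq_mul_integral
    ((measurable_of_finite c).comp (hj.measurable n)).aestronglyMeasurable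
    (measurable_comp_prefix hj.measurable n g).aestronglyMeasurable
  rw [hj.integral_comp c n, hc, zero_mul] at h3
  exact h3

end Random

end SparseInversion

namespace SparseInversion

variable {d : ℕ} {F : E d → E d} {K : ℝ≥0}

/-! ### The mean square error. -/

section MeanSquare

variable {lam π₁ π₂ ε : ℝ} {u₀ : E d} {V : (ℕ → Fin 2) → ℝ → E d}
  {Ω : Type*} [MeasurableSpace Ω] {P : Measure Ω} {j : ℕ → Ω → Fin 2}

theorem integrable_mul_comp_prefix [IsFiniteMeasure P] (hj : ∀ k, Measurable (j k)) (n : ℕ)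
    (c : Fin 2 → ℝ) (g : (Finset.range n → Fin 2) → ℝ) :
    Integrable (fun ω => c (j n ω) * g fun i => j i ω) P :=
  integrable_comp_prefix hj (n + 1) fun τ => c (τ ⟨n, by simp⟩) *
    g fun i => τ ⟨i, Finset.range_subset_range.2 n.le_succ i.2⟩

/-- Every function of the state at a fixed time is a function of finitely many choices. -/
theorem IsFlowFamily.exists_prefix (hV : IsFlowFamily F lam π₁ π₂ u₀ ε V) (hmon : IsMonotone F)
    (hlam : 0 ≤ lam) (hπ₁ : 0 < π₁) (hπ₂ : 0 < π₂) (hε : 0 < ε) {t : ℝ} (ht : 0 ≤ t) :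
    ∃ n : ℕ, ∀ σ, V σ t = V (extendChoice n fun i => σ i) t := by
  obtain ⟨n, hn⟩ := exists_nat_ge (t / ε)
  exact ⟨n, fun σ => hV.apply_eq hmon hlam hπ₁ hπ₂ hε σ ht ((div_le_iff₀ hε).1 hn)⟩

theorem IsFlowFamily.measurable (hV : IsFlowFamily F lam π₁ π₂ u₀ ε V) (hmon : IsMonotone F)
    (hlam : 0 ≤ lam) (hπ₁ : 0 < π₁) (hπ₂ : 0 < π₂) (hε : 0 < ε) (hj : ∀ k, Measurable (j k))
    {t : ℝ} (ht : 0 ≤ t) : Measurable fun ω => V (fun k => j k ω) t := by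
  obtain ⟨n, hn⟩ := hV.exists_prefix hmon hlam hπ₁ hπ₂ hε ht
  rw [funext fun ω => hn fun k => j k ω]
  exact measurable_comp_prefix hj n fun τ => V (extendChoice n τ) t

theorem IsFlowFamily.integrable [IsFiniteMeasure P] (hV : IsFlowFamily F lam π₁ π₂ u₀ ε V)
    (hmon : IsMonotone F) (hlam : 0 ≤ lam) (hπ₁ : 0 < π₁) (hπ₂ : 0 < π₂) (hε : 0 < ε)
    (hj : ∀ k, Measurable (j k)) {t : ℝ} (ht : 0 ≤ t) (g : E d → ℝ) :
    Integrable (fun ω => g (V (fun k => j k ω) t)) P := by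
  obtain ⟨n, hn⟩ := hV.exists_prefix hmon hlam hπ₁ hπ₂ hε ht
  rw [funext fun ω => congrArg g (hn fun k => j k ω)]
  exact integrable_comp_prefix hj n fun τ => g (V (extendChoice n τ) t)

/-- Bounds for all flows of a family. -/
theorem exists_forall_isFlowFamily_bounds (hF : LipschitzWith K F) (hmon : IsMonotone F)
    (hlam : 0 ≤ lam) (hπ₁ : 0 < π₁) (hπ₂ : 0 < π₂) (u₀ : E d) (T : ℝ) (hT : 0 ≤ T) :
    ∃ R L : ℝ, 0 ≤ R ∧ 0 ≤ L ∧
      (∀ ε V, IsFlowFamily F lam π₁ π₂ u₀ ε V → ∀ σ, (∀ t ∈ Icc 0 T, ‖V σ t‖ ≤ R) ∧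
        ∀ s t, 0 ≤ s → s ≤ t → t ≤ T → ‖V σ t - V σ s‖ ≤ L * (t - s)) ∧
      ∀ u : ℝ → E d, u 0 = u₀ → IsFlowOn F (fun _ => 1) (fun _ => lam) T u →
        (∀ t ∈ Icc 0 T, ‖u t‖ ≤ R) ∧
        ∀ s t, 0 ≤ s → s ≤ t → t ≤ T → ‖u t - u s‖ ≤ L * (t - s) := by
  have h1 : 0 < 1 / π₁ := by positivity
  have h2 : 0 < 1 / π₂ := by positivity
  -- The summands 1 make the bounds cover the rates `1` and `lam` of the averaged flow as well.
  obtain ⟨R, L, hR, hL, h⟩ := exists_forall_isFlowOn_bounds hF hmon (1 + 1 / π₁)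
    ((1 + 1 / π₂) * lam) T u₀ (by positivity) (by positivity)
  refine ⟨R, L, hR, hL, fun ε V hV σ => ?_, fun u hu0 hu => ?_⟩
  · exact h _ _ (V σ) (fun t => ⟨lsRate_nonneg hπ₁ _, lsRate_le hπ₁ _⟩)
      (fun t => ⟨mul_nonneg (shrinkRate_nonneg hπ₂ _) hlam,
        mul_le_mul_of_nonneg_right (shrinkRate_le hπ₂ _) hlam⟩) ((hV σ).2 T hT) (hV σ).1
  · exact h _ _ u (fun t => ⟨zero_le_one, by linarith⟩)
      (fun t => ⟨hlam, by nlinarith⟩) hu hu0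

/-- The mean square distance between the random flows and the flow is of the order of the step
length. -/
theorem exists_forall_integral_norm_sub_sq_le [IsProbabilityMeasure P] (hF : LipschitzWith K F)
    (hmon : IsMonotone F) (hlam : 0 ≤ lam) (hπ₁ : 0 < π₁) (hπ₂ : 0 < π₂) (hπ : π₁ + π₂ = 1)
    (hj : IsBatchSequence P π₁ π₂ j) {u : ℝ → E d} {T : ℝ} (hT : 0 ≤ T) (hu0 : u 0 = u₀)
    (hu : IsFlowOn F (fun _ => 1) (fun _ => lam) T u) :
    ∃ C : ℝ, 0 ≤ C ∧ ∀ ε V, 0 < ε → IsFlowFamily F lam π₁ π₂ u₀ ε V → ∀ t ∈ Icc 0 T,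
      ∫ ω, ‖V (fun k => j k ω) t - u t‖ ^ 2 ∂P ≤ C * ε := by
  have hp1 : 0 < 1 / π₁ := by positivity
  have hp2 : 0 < 1 / π₂ := by positivity
  obtain ⟨R, L, hR, hL, hVb, hub⟩ :=
    exists_forall_isFlowFamily_bounds hF hmon hlam hπ₁ hπ₂ u₀ T hT
  obtain ⟨huR, huL⟩ := hub u hu0 hu
  set B := K * R + ‖F 0‖ with hB
  have hB0 : 0 ≤ B := by positivity
  set G := (1 + 1 / π₁) * B + (1 + 1 / π₂) * (lam * Real.sqrt d) with hG
  have hG0 : 0 ≤ G := by positivity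
  set C := 2 * G * L with hC
  have hC0 : 0 ≤ C := by positivity
  refine ⟨C * T, by positivity, fun ε V hε hV => ?_⟩
  set e : ℝ → ℝ := fun t => ∫ ω, ‖V (fun k => j k ω) t - u t‖ ^ 2 ∂P with he
  have hstep : ∀ (k : ℕ) (t : ℝ), k * ε ≤ t → t ≤ (k + 1) * ε → t ≤ T →
      e t ≤ e (k * ε) + C * (t - k * ε) ^ 2 := by
    intro k t hkt htk htT
    have hs0 : 0 ≤ (k : ℝ) * ε := by positivity
    set s := (k : ℝ) * ε with hs
    -- `D` and `X` depend on the choices `0, …, k - 1`, whereas choice `k` governs the current step.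
    -- The factors `c₁`, `c₂` of that choice have mean zero because `π₁ + π₂ = 1`.
    let D : (Finset.range k → Fin 2) → E d := fun τ => V (extendChoice k τ) s - u s
    let X : (Finset.range k → Fin 2) → ℝ := fun τ => ∫ r in s..t, ⟪D τ, F (u r)⟫
    let c₁ : Fin 2 → ℝ := fun i => 1 - lsRate π₁ i
    let c₂ : Fin 2 → ℝ := fun i => shrinkRate π₂ i - 1
    have hD : ∀ ω, V (fun k => j k ω) s - u s = D fun i => j i ω := fun ω => by
      rw [hV.apply_eq hmon hlam hπ₁ hπ₂ hε (fun k => j k ω) hs0 le_rfl]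
    have hpt : ∀ ω, ‖V (fun k => j k ω) t - u t‖ ^ 2 ≤ ‖D fun i => j i ω‖ ^ 2
        + 2 * (c₁ (j k ω) * X fun i => j i ω)
        + 2 * (c₂ (j k ω) * (⟪D fun i => j i ω, u t - u s⟫ + X fun i => j i ω))
        + C * (t - s) ^ 2 := by
      intro ω
      have hfl : ∀ r ∈ Ioo s t, ⌊r / ε⌋₊ = k := by
        intro r hr
        rw [Nat.floor_eq_iff (div_nonneg (hs0.trans hr.1.le) hε.le)]
        exact ⟨(le_div_iff₀ hε).2 hr.1.le, (div_lt_iff₀ hε).2 (hr.2.trans_le htk)⟩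
      have h := norm_sub_sq_le_of_step (L := L) (B := B) (G := G)
        (α := lsRate π₁ (j k ω)) (β := shrinkRate π₂ (j k ω)) hF.continuous hmon hlam
        (lsRate_nonneg hπ₁ _) (shrinkRate_nonneg hπ₂ _) hu ((hV fun k => j k ω).2 T hT) hs0 hkt htT
        (fun r hr => by simp only [hfl r hr]) (fun r hr => by simp only [hfl r hr])
        (fun r hr => huL s r hs0 hr.1 (hr.2.trans htT))
        (fun r hr => (hVb ε V hV _).2 s r hs0 hr.1 (hr.2.trans htT))
        (fun r hr => (norm_le_of_lipschitzWith hF _).trans (by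
          have := huR r ⟨hs0.trans hr.1, hr.2.trans htT⟩
          rw [hB]; gcongr))
        (by
          have h1 : |1 - lsRate π₁ (j k ω)| ≤ 1 + 1 / π₁ := abs_le.2
            ⟨by linarith [lsRate_le hπ₁ (j k ω)], by linarith [lsRate_nonneg hπ₁ (j k ω)]⟩
          have h2 : |1 - shrinkRate π₂ (j k ω)| ≤ 1 + 1 / π₂ := abs_le.2
            ⟨by linarith [shrinkRate_le hπ₂ (j k ω)], by linarith [shrinkRate_nonneg hπ₂ (j k ω)]⟩
          rw [hG]; gcongr)
      rw [hD] at h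
      exact h
    have hi0 : Integrable (fun ω => ‖D fun i => j i ω‖ ^ 2) P :=
      integrable_comp_prefix hj.measurable k fun τ => ‖D τ‖ ^ 2
    have hi1 : Integrable (fun ω => 2 * (c₁ (j k ω) * X fun i => j i ω)) P :=
      (integrable_mul_comp_prefix hj.measurable k c₁ X).const_mul 2
    have hi2 : Integrable
        (fun ω => 2 * (c₂ (j k ω) * (⟪D fun i => j i ω, u t - u s⟫ + X fun i => j i ω))) P :=
      (integrable_mul_comp_prefix hj.measurable k c₂
        fun τ => ⟪D τ, u t - u s⟫ + X τ).const_mul 2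
    have hz1 : ∫ ω, c₁ (j k ω) * X (fun i => j i ω) ∂P = 0 := by
      refine hj.integral_mul_comp_prefix ?_ k X
      simp only [c₁, lsRate]
      norm_num
      field_simp
      linarith
    have hz2 : ∫ ω, c₂ (j k ω) * (⟪D fun i => j i ω, u t - u s⟫ + X fun i => j i ω) ∂P = 0 := by
      refine hj.integral_mul_comp_prefix ?_ k fun τ => ⟪D τ, u t - u s⟫ + X τ
      simp only [c₂, shrinkRate]
      norm_num
      field_simp
      linarith
    have hle := integral_mono
      (hV.integrable (P := P) hmon hlam hπ₁ hπ₂ hε hj.measurable (hs0.trans hkt)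
        fun x => ‖x - u t‖ ^ 2)
      (((hi0.fun_add hi1).fun_add hi2).fun_add (integrable_const (C * (t - s) ^ 2))) hpt
    rw [integral_add ((hi0.fun_add hi1).fun_add hi2) (integrable_const _),
      integral_add (hi0.fun_add hi1) hi2, integral_add hi0 hi1, integral_const_mul,
      integral_const_mul, hz1, hz2] at hle
    simp only [mul_zero, add_zero, integral_const, probReal_univ, one_smul] at hle
    simp only [he]
    simp only [hD]
    exact hle
  -- Each full step adds `C ε²`, and `k` steps cover the time `k ε`.
  have hgrid : ∀ k : ℕ, k * ε ≤ T → e (k * ε) ≤ C * ε * (k * ε) := by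
    intro k
    induction k with
    | zero => intro _; simp [he, (hV _).1, hu0]
    | succ k ih =>
      intro hk
      push_cast at hk ⊢
      have h1 := ih (by linarith)
      have h2 := hstep k ((k + 1) * ε) (by linarith) le_rfl hk
      have h3 : C * ((k + 1) * ε - k * ε) ^ 2 = C * ε * ε := by ring
      rw [h3] at h2
      linarith
  intro t ht
  have hf1 : ⌊t / ε⌋₊ * ε ≤ t :=
    (le_div_iff₀ hε).1 (Nat.floor_le (div_nonneg ht.1 hε.le))
  have hf2 : t ≤ (⌊t / ε⌋₊ + 1) * ε := ((div_lt_iff₀ hε).1 (Nat.lt_floor_add_one _)).le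
  have h1 := hstep ⌊t / ε⌋₊ t hf1 hf2 ht.2
  have h2 := hgrid ⌊t / ε⌋₊ (hf1.trans ht.2)
  have h3 : (t - ⌊t / ε⌋₊ * ε) ^ 2 ≤ ε * (t - ⌊t / ε⌋₊ * ε) := by
    rw [sq]
    exact mul_le_mul_of_nonneg_right (by linarith) (by linarith)
  have h4 := mul_le_mul_of_nonneg_left h3 hC0
  have h5 : C * ε * t ≤ C * ε * T := mul_le_mul_of_nonneg_left ht.2 (by positivity)
  change e t ≤ _
  linarith

end MeanSquare

end SparseInversion

namespace SparseInversion

variable {r d : ℕ} {A : Matrix (Fin r) (Fin d) ℝ} {b : E r} {lam : ℝ}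

/-! ### The objective: subgradients and minimizers. -/

section Objective

theorem inner_lsGrad (A : Matrix (Fin r) (Fin d) ℝ) (b : E r) (x y : E d) :
    ⟪lsGrad A b x, y⟫ = ⟪Matrix.toEuclideanLin A x - b, Matrix.toEuclideanLin A y⟫ := by
  rw [lsGrad, ← Matrix.conjTranspose_eq_transpose_of_trivial,
    Matrix.toEuclideanLin_conjTranspose_eq_adjoint, LinearMap.adjoint_inner_left]

theorem lsGrad_isMonotone (A : Matrix (Fin r) (Fin d) ℝ) (b : E r) : IsMonotone (lsGrad A b) := by
  intro x y
  rw [inner_sub_left, inner_lsGrad, inner_lsGrad, ← inner_sub_left, sub_sub_sub_cancel_right,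
    ← map_sub]
  exact real_inner_self_nonneg

theorem exists_lipschitzWith_lsGrad (A : Matrix (Fin r) (Fin d) ℝ) (b : E r) :
    ∃ K, LipschitzWith K (lsGrad A b) := by
  refine ⟨_, (Matrix.toEuclideanLin A.transpose).toContinuousLinearMap.lipschitz.comp
    ((Matrix.toEuclideanLin A).toContinuousLinearMap.lipschitz.sub (LipschitzWith.const b))⟩

theorem continuous_objective (A : Matrix (Fin r) (Fin d) ℝ) (b : E r) (lam : ℝ) :
    Continuous (objective A b lam) := by
  have h1 : Continuous (Matrix.toEuclideanLin A) := LinearMap.continuous_of_finiteDimensional _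
  unfold objective l1Norm
  fun_prop

/-- The vectors `Aᵀ (A x - b) + lam η`, `η ∈ Θ(x)`, are subgradients of the objective. -/
theorem inner_le_objective_sub (hlam : 0 ≤ lam) {x η : E d} (hη : η ∈ signSet x) (y : E d) :
    ⟪lsGrad A b x + lam • η, y - x⟫ ≤ objective A b lam y - objective A b lam x := by
  rw [inner_add_left, inner_lsGrad, real_inner_smul_left, inner_sub_right,
    inner_eq_l1Norm_of_mem_signSet hη, map_sub]
  have h1 := mul_le_mul_of_nonneg_left (inner_le_l1Norm_of_mem_signSet hη y) hlam
  have h2 : Matrix.toEuclideanLin A y - b = (Matrix.toEuclideanLin A x - b)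
      + (Matrix.toEuclideanLin A y - Matrix.toEuclideanLin A x) := by abel
  have h3 := norm_add_sq_real (Matrix.toEuclideanLin A x - b)
    (Matrix.toEuclideanLin A y - Matrix.toEuclideanLin A x)
  rw [← h2] at h3
  have h4 := sq_nonneg ‖Matrix.toEuclideanLin A y - Matrix.toEuclideanLin A x‖
  unfold objective
  linarith

theorem norm_le_l1Norm (u : E d) : ‖u‖ ≤ l1Norm u := by
  rcases (norm_nonneg u).eq_or_lt with h | h
  · rw [← h]; exact l1Norm_nonneg u
  · refine le_of_mul_le_mul_left ?_ h
    rw [← sq, EuclideanSpace.real_norm_sq_eq, l1Norm, Finset.mul_sum]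
    refine Finset.sum_le_sum fun i _ => ?_
    rw [← sq_abs, sq]
    exact mul_le_mul_of_nonneg_right (PiLp.norm_apply_le u i) (abs_nonneg _)

/-- For `lam > 0` the `ℓ¹` term makes the objective coercive. For `lam = 0` coercivity may fail, and
a minimizer comes from projecting `b` onto the range of `A`. -/
theorem exists_forall_objective_le (A : Matrix (Fin r) (Fin d) ℝ) (b : E r) (hlam : 0 ≤ lam) :
    ∃ x, ∀ w, objective A b lam x ≤ objective A b lam w := by
  rcases hlam.eq_or_lt with h | h
  · obtain ⟨y, hy, hmin⟩ := (LinearMap.range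
      (Matrix.toEuclideanLin A)).exists_norm_eq_iInf_of_complete_subspace
      (Submodule.complete_of_finiteDimensional _) b
    obtain ⟨x, rfl⟩ := hy
    refine ⟨x, fun w => ?_⟩
    have h1 : ‖b - Matrix.toEuclideanLin A x‖ ≤ ‖b - Matrix.toEuclideanLin A w‖ := by
      rw [hmin]
      exact ciInf_le ⟨0, by rintro _ ⟨z, rfl⟩; exact norm_nonneg _⟩
        (⟨Matrix.toEuclideanLin A w, LinearMap.mem_range_self _ w⟩ :
          LinearMap.range (Matrix.toEuclideanLin A))
    rw [norm_sub_rev, norm_sub_rev b] at h1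
    unfold objective
    rw [← h, zero_mul, zero_mul]
    gcongr
  · refine (continuous_objective A b lam).exists_forall_le ?_
    refine tendsto_atTop_mono (fun u => ?_)
      ((tendsto_norm_cocompact_atTop (E := E d)).const_mul_atTop h)
    have h1 := mul_le_mul_of_nonneg_left (norm_le_l1Norm u) h.le
    unfold objective
    nlinarith [sq_nonneg ‖Matrix.toEuclideanLin A u - b‖]

end Objective

/-! ### Long-time behaviour of the deterministic flow. -/

section Asymptotics

variable {u : ℝ → E d} {T : ℝ}

/-- Integrated form of `(‖u - x‖²)' ≤ 2 (Φ(x) - Φ(u))`. With `c = 0` it yields Fejér monotonicity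
with respect to minimizers; with `c > 0` it limits how long the objective can exceed `Φ(x) + c`. -/
theorem IsFlowOn.norm_sub_sq_add_le (hlam : 0 ≤ lam)
    (hu : IsFlowOn (lsGrad A b) (fun _ => 1) (fun _ => lam) T u) {s t c : ℝ} (hs : 0 ≤ s)
    (hst : s ≤ t) (ht : t ≤ T) (x : E d)
    (hc : ∀ q ∈ Ioo s t, objective A b lam x + c ≤ objective A b lam (u q)) :
    ‖u t - x‖ ^ 2 + 2 * c * (t - s) ≤ ‖u s - x‖ ^ 2 := by
  have h1 : AbsolutelyContinuousOnInterval (fun q => ‖u q - x‖ ^ 2 + 2 * c * (q - s)) s t :=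
    (((hu.absolutelyContinuous_Icc hs hst ht).fun_sub
      (ContDiffOn.absolutelyContinuousOnInterval contDiffOn_const)).norm_sq).fun_add
      (ContDiffOn.absolutelyContinuousOnInterval (by fun_prop))
  have h2 := h1.le_of_ae_deriv_nonpos hst (by
    filter_upwards [hu.ae_flowAt_Ioo hs ht] with q hq hqI
    obtain ⟨w, hw, η, hη, hwe⟩ := hq hqI
    refine ⟨_, ((hw.sub_const x).norm_sq).add
      (((hasDerivAt_id q).sub_const s).const_mul (2 * c)), ?_⟩
    have h3 := inner_le_objective_sub (A := A) (b := b) hlam hη x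
    rw [one_smul] at hwe
    rw [← hwe, inner_neg_left, ← inner_neg_right, neg_sub, real_inner_comm] at h3
    linarith [hc q hqI])
  simpa using h2

/-- The flow of the objective converges to a minimizer. -/
theorem exists_minimizer_forall_norm_sub_le (hlam : 0 ≤ lam)
    (hu : ∀ T, 0 ≤ T → IsFlowOn (lsGrad A b) (fun _ => 1) (fun _ => lam) T u) :
    ∃ y, (∀ w, objective A b lam y ≤ objective A b lam w) ∧
      ∀ δ, 0 < δ → ∃ T, 0 < T ∧ ‖u T - y‖ ≤ δ := by
  obtain ⟨x, hx⟩ := exists_forall_objective_le A b hlam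
  have hfejer : ∀ y, (∀ w, objective A b lam y ≤ objective A b lam w) →
      ∀ s t, 0 ≤ s → s ≤ t → ‖u t - y‖ ≤ ‖u s - y‖ := by
    intro y hy s t hs hst
    have := (hu t (hs.trans hst)).norm_sub_sq_add_le hlam (c := 0) hs hst le_rfl y
      (fun q _ => by rw [add_zero]; exact hy _)
    rw [mul_zero, zero_mul, add_zero] at this
    exact (sq_le_sq₀ (norm_nonneg _) (norm_nonneg _)).1 this
  have hnear : ∀ n : ℕ, ∃ t, 0 ≤ t ∧
      objective A b lam (u t) ≤ objective A b lam x + 1 / ((n : ℝ) + 1) := by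
    intro n
    by_contra! hcon
    set c : ℝ := 1 / ((n : ℝ) + 1) with hc
    have hc0 : 0 < c := Nat.one_div_pos_of_nat
    -- Up to this time the gap `c` would lower the squared distance by `‖u 0 - x‖² + 1`, more than
    -- is available.
    have hT : 0 ≤ (‖u 0 - x‖ ^ 2 + 1) / (2 * c) := by positivity
    have h1 := (hu _ hT).norm_sub_sq_add_le hlam (c := c) le_rfl hT le_rfl x
      (fun q hq => (hcon q hq.1.le).le)
    rw [sub_zero, mul_div_cancel₀ _ (by positivity)] at h1
    linarith [sq_nonneg ‖u ((‖u 0 - x‖ ^ 2 + 1) / (2 * c)) - x‖]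
  choose τ hτ0 hτ using hnear
  have hmem : ∀ n, u (τ n) ∈ Metric.closedBall x ‖u 0 - x‖ := fun n => by
    rw [mem_closedBall_iff_norm]
    exact hfejer x hx 0 (τ n) le_rfl (hτ0 n)
  obtain ⟨y, -, φ, hφ, hlim⟩ := (isCompact_closedBall x ‖u 0 - x‖).tendsto_subseq hmem
  have hy : ∀ w, objective A b lam y ≤ objective A b lam w := by
    intro w
    refine le_trans ?_ (hx w)
    have h1 : Tendsto (fun n => objective A b lam x + 1 / (((φ n : ℕ) : ℝ) + 1)) atTop
        (𝓝 (objective A b lam x + 0)) :=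
      (tendsto_one_div_add_atTop_nhds_zero_nat.comp hφ.tendsto_atTop).const_add _
    rw [add_zero] at h1
    exact le_of_tendsto_of_tendsto' (((continuous_objective A b lam).tendsto y).comp hlim) h1
      fun n => hτ (φ n)
  refine ⟨y, hy, fun δ hδ => ?_⟩
  obtain ⟨n, hn⟩ := (Metric.tendsto_nhds.1 hlim δ hδ).exists
  rw [dist_eq_norm] at hn
  -- `τ (φ n)` may be zero and `T` must be positive; by Fejér monotonicity with respect to `y`,
  -- waiting longer does no harm.
  refine ⟨τ (φ n) + 1, by linarith [hτ0 (φ n)], le_trans ?_ hn.le⟩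
  exact hfejer y hy (τ (φ n)) _ (hτ0 _) (by linarith)

end Asymptotics

/-! ### The original flows as instances of the general inclusion. -/

section Translation

theorem isSparseFlow_iff {u₀ : E d} {u : ℝ → E d} :
    IsSparseFlow A b lam u₀ u ↔
      u 0 = u₀ ∧ ∀ T, 0 ≤ T → IsFlowOn (lsGrad A b) (fun _ => 1) (fun _ => lam) T u := by
  constructor
  · intro h
    refine ⟨h.initial, fun T hT => ?_⟩
    -- `T = 0` is allowed here, but local absolute continuity concerns positive times only, hence `T
    -- + 1`.
    refine IsFlowOn.mono (T := T + 1) ⟨h.locallyAC _ (by linarith), ?_⟩ hT (by linarith)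
    filter_upwards [(ae_restrict_iff' measurableSet_Ioi).1 h.inclusion] with t ht htI
    obtain ⟨w, hw, η, hη, hwe⟩ := ht htI.1
    exact ⟨w, hw, η, hη, by rwa [one_smul]⟩
  · rintro ⟨h0, h⟩
    refine ⟨fun T hT => (h T hT.le).absolutelyContinuous, h0, ?_⟩
    rw [ae_restrict_iff' measurableSet_Ioi]
    filter_upwards [ae_all_iff.2 fun n : ℕ => (h n n.cast_nonneg).flowAt] with t ht htI
    obtain ⟨n, hn⟩ := exists_nat_gt t
    obtain ⟨w, hw, η, hη, hwe⟩ := ht n ⟨htI, hn⟩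
    exact ⟨w, hw, η, hη, by rwa [one_smul] at hwe⟩

/-- Exactly one of the two rates is nonzero on each step. During a least-squares step the sign term
has weight zero, so any element of the nonempty set `Θ(v t)` completes the inclusion. -/
theorem isMiniBatchFlow_iff {π₁ π₂ ε : ℝ} (hε : 0 < ε) {u₀ : E d} {σ : ℕ → Fin 2} {v : ℝ → E d} :
    IsMiniBatchFlow A b lam π₁ π₂ u₀ ε σ v ↔
      v 0 = u₀ ∧ ∀ T, 0 ≤ T → IsFlowOn (lsGrad A b) (fun t => lsRate π₁ (σ ⌊t / ε⌋₊))
        (fun t => shrinkRate π₂ (σ ⌊t / ε⌋₊) * lam) T v := by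
  constructor
  · intro h
    refine ⟨h.initial, fun T hT => ?_⟩
    refine IsFlowOn.mono (T := T + 1) ⟨h.locallyAC _ (by linarith), ?_⟩ hT (by linarith)
    have h1 : ∀ᵐ t, ∀ k : ℕ, σ k = 0 → t ∈ Ico ((k : ℝ) * ε) (((k : ℝ) + 1) * ε) →
        ∃ w, HasDerivAt v w t ∧ -w = (1 / π₁) • lsGrad A b (v t) := by
      refine ae_all_iff.2 fun k => ?_
      by_cases hk : σ k = 0
      · filter_upwards [(ae_restrict_iff' measurableSet_Ico).1 (h.leastSquares k hk)] with t ht _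
        exact ht
      · exact Eventually.of_forall fun t hk' => absurd hk' hk
    have h2 : ∀ᵐ t, ∀ k : ℕ, σ k = 1 → t ∈ Ico ((k : ℝ) * ε) (((k : ℝ) + 1) * ε) →
        ∃ w, HasDerivAt v w t ∧ -w ∈ (lam / π₂) • signSet (v t) := by
      refine ae_all_iff.2 fun k => ?_
      by_cases hk : σ k = 1
      · filter_upwards [(ae_restrict_iff' measurableSet_Ico).1 (h.shrinking k hk)] with t ht _
        exact ht
      · exact Eventually.of_forall fun t hk' => absurd hk' hk
    filter_upwards [h1, h2] with t h1 h2 htI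
    have hmem : t ∈ Ico ((⌊t / ε⌋₊ : ℝ) * ε) (((⌊t / ε⌋₊ : ℝ) + 1) * ε) :=
      ⟨(le_div_iff₀ hε).1 (Nat.floor_le (div_nonneg htI.1.le hε.le)),
        (div_lt_iff₀ hε).1 (Nat.lt_floor_add_one _)⟩
    rcases Fin.exists_fin_two.1 ⟨σ ⌊t / ε⌋₊, rfl⟩ with hk | hk
    · obtain ⟨w, hw, hwe⟩ := h1 _ hk hmem
      obtain ⟨η, hη⟩ := signSet_nonempty (v t)
      exact ⟨w, hw, η, hη, by rw [hwe]; simp [lsRate, shrinkRate, hk]⟩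
    · obtain ⟨w, hw, η, hη, hwe⟩ := h2 _ hk hmem
      refine ⟨w, hw, η, hη, ?_⟩
      rw [← hwe, hk]
      simp [lsRate, shrinkRate, div_eq_inv_mul]
  · rintro ⟨h0, h⟩
    have hfl : ∀ (k : ℕ), ∀ᵐ t, t ∈ Ico ((k : ℝ) * ε) (((k : ℝ) + 1) * ε) →
        FlowAt (lsGrad A b) (lsRate π₁ (σ k)) (shrinkRate π₂ (σ k) * lam) v t := by
      intro k
      filter_upwards [(h ((k + 1) * ε) (by positivity)).flowAt, Measure.ae_ne volume 0]
        with t ht hne htI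
      have ht0 : 0 ≤ t := (by positivity : (0 : ℝ) ≤ k * ε).trans htI.1
      have hk : ⌊t / ε⌋₊ = k := by
        rw [Nat.floor_eq_iff (div_nonneg ht0 hε.le)]
        exact ⟨(le_div_iff₀ hε).2 htI.1, (div_lt_iff₀ hε).2 htI.2⟩
      have h1 := ht ⟨lt_of_le_of_ne ht0 hne.symm, htI.2⟩
      rwa [hk] at h1
    refine ⟨fun T hT => (h T hT.le).absolutelyContinuous, h0, fun k hk => ?_, fun k hk => ?_⟩
    · rw [ae_restrict_iff' measurableSet_Ico]
      filter_upwards [hfl k] with t ht htI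
      obtain ⟨w, hw, η, -, hwe⟩ := ht htI
      exact ⟨w, hw, by rw [hwe]; simp [lsRate, shrinkRate, hk]⟩
    · rw [ae_restrict_iff' measurableSet_Ico]
      filter_upwards [hfl k] with t ht htI
      obtain ⟨w, hw, η, hη, hwe⟩ := ht htI
      refine ⟨w, hw, η, hη, ?_⟩
      rw [hwe]
      simp [lsRate, shrinkRate, hk, div_eq_inv_mul]

theorem eqOn_Ici_of_isFlowOn {F : E d → E d} (hmon : IsMonotone F) {a m : ℝ → ℝ} {u v : ℝ → E d}
    (ha : ∀ t, 0 ≤ a t) (hm : ∀ t, 0 ≤ m t) (h0 : u 0 = v 0)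
    (hu : ∀ T, 0 ≤ T → IsFlowOn F a m T u) (hv : ∀ T, 0 ≤ T → IsFlowOn F a m T v) :
    EqOn u v (Ici 0) :=
  fun t ht => (hu t ht).eqOn hmon ha hm (hv t ht) h0 ⟨ht, le_rfl⟩

/-- Serves the degenerate case `Γ(u₀) = 0`, in which uniqueness pins all flows to `u₀`. -/
theorem isFlowOn_const_of_eq_zero {F : E d → E d} {x : E d} (hx : F x = 0) (a : ℝ → ℝ) {m : ℝ → ℝ}
    (hm : ∀ t, m t = 0) (T : ℝ) : IsFlowOn F a m T fun _ => x := by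
  refine ⟨ContDiffOn.absolutelyContinuousOnInterval contDiffOn_const,
    Eventually.of_forall fun t _ => ?_⟩
  obtain ⟨η, hη⟩ := signSet_nonempty x
  exact ⟨0, hasDerivAt_const t x, η, hη, by simp [hx, hm]⟩

end Translation

end SparseInversion

/-! ### Auxiliary facts on `Γ` and on values of the objective. -/

namespace SparseInversion

theorem locallyLipschitzOn_Ici {V : Type*} [PseudoMetricSpace V] {v : ℝ → V}
    (h : ∀ T, 0 ≤ T → ∃ L, LipschitzOnWith L v (Icc 0 T)) : LocallyLipschitzOn (Ici 0) v := by
  intro x hx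
  obtain ⟨L, hL⟩ := h (x + 1) (by linarith [mem_Ici.1 hx])
  refine ⟨L, Icc 0 (x + 1), ?_, hL⟩
  rw [← Ici_inter_Iic]
  exact inter_mem_nhdsWithin _ (Iic_mem_nhds (by linarith))

variable {r d : ℕ} {A : Matrix (Fin r) (Fin d) ℝ} {b : E r} {lam π₁ π₂ : ℝ} {u₀ : E d}

theorem Gam_nonneg (hπ₁ : 0 < π₁) (hπ₂ : 0 < π₂) (x : E d) : 0 ≤ Gam A b lam π₁ π₂ x := by
  unfold Gam
  positivity

theorem eq_zero_of_Gam_eq_zero (hd : 0 < d) (hπ₁ : 0 < π₁) (hπ₂ : 0 < π₂) {x : E d}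
    (h : Gam A b lam π₁ π₂ x = 0) : lsGrad A b x = 0 ∧ lam = 0 := by
  unfold Gam at h
  obtain ⟨h1, h2⟩ := (add_eq_zero_iff_of_nonneg (by positivity) (by positivity)).1 h
  have h3 : π₂ ^ 2 / π₁ ≠ 0 := by positivity
  have h4 : π₁ ^ 2 / π₂ ≠ 0 := by positivity
  have h5 : (d : ℝ) ≠ 0 := by positivity
  simp only [mul_eq_zero, h3, h4, h5, false_or, or_false, ne_eq, OfNat.ofNat_ne_zero,
    not_false_eq_true, pow_eq_zero_iff, norm_eq_zero] at h1 h2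
  exact ⟨h1, h2⟩

theorem continuous_Gam (A : Matrix (Fin r) (Fin d) ℝ) (b : E r) (lam π₁ π₂ : ℝ) :
    Continuous (Gam A b lam π₁ π₂) := by
  obtain ⟨K, hK⟩ := exists_lipschitzWith_lsGrad A b
  have := hK.continuous
  unfold Gam
  fun_prop

/-- The objective at one point of a ball is bounded by its value at another point and the squared
distance. -/
theorem objective_le_add {K : ℝ≥0} (hK : LipschitzWith K (lsGrad A b)) (hlam : 0 ≤ lam) {R : ℝ}
    {x y : E d} (hx : ‖x‖ ≤ R) {η : ℝ} (hη : 0 < η) :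
    objective A b lam x ≤ objective A b lam y + η
      + (K * R + ‖lsGrad A b 0‖ + lam * Real.sqrt d) ^ 2 / (4 * η) * ‖x - y‖ ^ 2 := by
  obtain ⟨ζ, hζ⟩ := signSet_nonempty x
  set Q := K * R + ‖lsGrad A b 0‖ + lam * Real.sqrt d with hQ
  have h1 := inner_le_objective_sub (A := A) (b := b) hlam hζ y
  have h2 := abs_real_inner_le_norm (lsGrad A b x + lam • ζ) (y - x)
  have h3 : ‖lsGrad A b x + lam • ζ‖ ≤ Q := by
    refine (norm_add_le _ _).trans ?_
    rw [norm_smul, Real.norm_of_nonneg hlam]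
    have h4 := norm_le_of_lipschitzWith hK x
    have h5 := norm_le_of_mem_signSet hζ
    refine (add_le_add h4 (mul_le_mul_of_nonneg_left h5 hlam)).trans ?_
    rw [hQ]
    gcongr
  have h4 := mul_le_mul_of_nonneg_right h3 (norm_nonneg (y - x))
  have h5 := (abs_le.1 (h2.trans h4)).1
  rw [norm_sub_rev] at h5
  -- Young's inequality turns the Lipschitz estimate into one in the squared distance, to which the
  -- mean square bound applies directly.
  have h6 : Q * ‖x - y‖ ≤ η + Q ^ 2 / (4 * η) * ‖x - y‖ ^ 2 := by
    have h7 : η + Q ^ 2 / (4 * η) * ‖x - y‖ ^ 2 - Q * ‖x - y‖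
        = (2 * η - Q * ‖x - y‖) ^ 2 / (4 * η) := by
      field_simp
      ring
    have h8 : 0 ≤ (2 * η - Q * ‖x - y‖) ^ 2 / (4 * η) := by positivity
    linarith
  linarith

end SparseInversion

end

/-! ### Assembly of the theorem. -/

theorem theorem4p2 {r d : ℕ} (hr : 0 < r) (hd : 0 < d)
    (A : Matrix (Fin r) (Fin d) ℝ) (b : SparseInversion.E r) (lam : ℝ) (hlam : 0 ≤ lam)
    (u₀ : SparseInversion.E d)
    (π₁ π₂ : ℝ) (hπ₁ : 0 < π₁) (hπ₂ : 0 < π₂) (hπ : π₁ + π₂ = 1)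
    {Ω : Type*} [MeasurableSpace Ω] (P : Measure Ω) [IsProbabilityMeasure P]
    (j : ℕ → Ω → Fin 2) (hj : SparseInversion.IsBatchSequence P π₁ π₂ j) :
    -- the sparse inversion flow `u` and the mini-batch flows `v ε ω`
    ∃ (u : ℝ → SparseInversion.E d) (v : ℝ → Ω → ℝ → SparseInversion.E d),
      -- `u` is the unique solution of the sparse inversion flow
      (SparseInversion.IsSparseFlow A b lam u₀ u ∧
        ∀ w, SparseInversion.IsSparseFlow A b lam u₀ w → EqOn w u (Ici 0)) ∧
      -- existence, uniqueness and local Lipschitz continuity of the mini-batch flow,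
      -- for every step length and every realization of the batches
      (∀ ε : ℝ, 0 < ε → ∀ ω : Ω,
        SparseInversion.IsMiniBatchFlow A b lam π₁ π₂ u₀ ε (fun k => j k ω) (v ε ω) ∧
        (∀ w, SparseInversion.IsMiniBatchFlow A b lam π₁ π₂ u₀ ε (fun k => j k ω) w →
          EqOn w (v ε ω) (Ici 0)) ∧
        LocallyLipschitzOn (Ici 0) (v ε ω)) ∧
      -- the state at each time is a random variable
      (∀ ε : ℝ, 0 < ε → ∀ t : ℝ, 0 ≤ t → Measurable (fun ω => v ε ω t)) ∧
      -- (i)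
      (∀ T : ℝ, 0 < T → ∃ c : ℝ, 0 < c ∧ ∀ ε : ℝ, 0 < ε → ∀ t ∈ Icc 0 T,
        Integrable (fun ω => ‖v ε ω t - u t‖ ^ 2) P ∧
        ∫ ω, ‖v ε ω t - u t‖ ^ 2 ∂P
          ≤ c * ε * ∫ s in (0 : ℝ)..T, SparseInversion.Gam A b lam π₁ π₂ (u s)) ∧
      -- (ii)
      (∀ η : ℝ, 0 < η → ∃ T : ℝ, 0 < T ∧ ∃ ε₀ : ℝ, 0 < ε₀ ∧ ∀ ε : ℝ, 0 < ε → ε < ε₀ →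
        Integrable (fun ω => SparseInversion.objective A b lam (v ε ω T)) P ∧
        ∫ ω, SparseInversion.objective A b lam (v ε ω T) ∂P
          ≤ (⨅ w, SparseInversion.objective A b lam w) + η) ∧
      -- (iii)
      (∃ uStar : SparseInversion.E d,
        (∀ w, SparseInversion.objective A b lam uStar ≤ SparseInversion.objective A b lam w) ∧
        ∀ η : ℝ, 0 < η → ∃ T : ℝ, 0 < T ∧ ∃ ε₀ : ℝ, 0 < ε₀ ∧ ∀ ε : ℝ, 0 < ε → ε < ε₀ →
          Integrable (fun ω => ‖v ε ω T - uStar‖ ^ 2) P ∧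
          ∫ ω, ‖v ε ω T - uStar‖ ^ 2 ∂P ≤ η) := by
  obtain ⟨K, hK⟩ := SparseInversion.exists_lipschitzWith_lsGrad A b
  have hmon := SparseInversion.lsGrad_isMonotone A b
  -- The coefficients are constant, so the grid length 1 is arbitrary.
  obtain ⟨u, hu0, hu⟩ := SparseInversion.exists_isFlowOn_piecewise hK hmon one_pos (M := 1)
    (α := fun _ => 1) (β := fun _ => lam) (fun _ => ⟨zero_le_one, le_rfl⟩) (fun _ => hlam) u₀
  have hex : ∀ ε : ℝ, ∃ V, 0 < ε →
      SparseInversion.IsFlowFamily (SparseInversion.lsGrad A b) lam π₁ π₂ u₀ ε V := fun ε => by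
    by_cases hε : 0 < ε
    · obtain ⟨V, hV⟩ := SparseInversion.exists_isFlowFamily hK hmon hlam hπ₁ hπ₂ u₀ hε
      exact ⟨V, fun _ => hV⟩
    · exact ⟨fun _ _ => 0, fun h => absurd h hε⟩
  choose V hV using hex
  have hint : ∀ ε, 0 < ε → ∀ t, 0 ≤ t → ∀ g : SparseInversion.E d → ℝ,
      Integrable (fun ω => g (V ε (fun k => j k ω) t)) P := fun ε hε t ht g =>
    (hV ε hε).integrable hmon hlam hπ₁ hπ₂ hε hj.measurable ht g
  have hmean : ∀ T, 0 ≤ T → ∃ C : ℝ, 0 ≤ C ∧ ∀ ε, 0 < ε → ∀ t ∈ Icc 0 T,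
      ∫ ω, ‖V ε (fun k => j k ω) t - u t‖ ^ 2 ∂P ≤ C * ε := by
    intro T hT
    obtain ⟨C, hC, h⟩ := SparseInversion.exists_forall_integral_norm_sub_sq_le hK hmon hlam hπ₁ hπ₂
      hπ hj hT hu0 (hu T hT)
    exact ⟨C, hC, fun ε hε => h ε (V ε) hε (hV ε hε)⟩
  obtain ⟨y, hy, hlim⟩ := SparseInversion.exists_minimizer_forall_norm_sub_le hlam hu
  refine ⟨u, fun ε ω => V ε fun k => j k ω, ⟨SparseInversion.isSparseFlow_iff.2 ⟨hu0, hu⟩, ?_⟩,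
    ?_, ?_, ?_, ?_, y, hy, ?_⟩
  · intro w hw
    obtain ⟨hw0, hw⟩ := SparseInversion.isSparseFlow_iff.1 hw
    exact SparseInversion.eqOn_Ici_of_isFlowOn hmon (fun _ => zero_le_one) (fun _ => hlam)
      (hw0.trans hu0.symm) hw hu
  · intro ε hε ω
    have hVω := hV ε hε fun k => j k ω
    refine ⟨(SparseInversion.isMiniBatchFlow_iff hε).2 hVω, fun w hw => ?_, ?_⟩
    · obtain ⟨hw0, hw⟩ := (SparseInversion.isMiniBatchFlow_iff hε).1 hw
      exact SparseInversion.eqOn_Ici_of_isFlowOn hmon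
        (fun _ => SparseInversion.lsRate_nonneg hπ₁ _)
        (fun _ => mul_nonneg (SparseInversion.shrinkRate_nonneg hπ₂ _) hlam)
        (hw0.trans hVω.1.symm) hw hVω.2
    · exact SparseInversion.locallyLipschitzOn_Ici fun T hT =>
        (hVω.2 T hT).exists_lipschitzOnWith hK hmon
          (fun _ => ⟨SparseInversion.lsRate_nonneg hπ₁ _, SparseInversion.lsRate_le hπ₁ _⟩)
          (fun _ => ⟨mul_nonneg (SparseInversion.shrinkRate_nonneg hπ₂ _) hlam,
            mul_le_mul_of_nonneg_right (SparseInversion.shrinkRate_le hπ₂ _) hlam⟩)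
  · intro ε hε t ht
    exact (hV ε hε).measurable hmon hlam hπ₁ hπ₂ hε hj.measurable ht
  · intro T hT
    have hGc : ContinuousOn (fun s => SparseInversion.Gam A b lam π₁ π₂ (u s)) (Icc 0 T) :=
      (SparseInversion.continuous_Gam A b lam π₁ π₂).comp_continuousOn
        ((hu T hT.le).continuousOn hT.le)
    have hG0 : ∀ s, 0 ≤ SparseInversion.Gam A b lam π₁ π₂ (u s) := fun s =>
      SparseInversion.Gam_nonneg hπ₁ hπ₂ _
    -- Either all flows stay at `u₀` and the error vanishes, or `Γ(u)` is positive at time 0 and, by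
    -- continuity, has positive integral.
    rcases (SparseInversion.Gam_nonneg (A := A) (b := b) (lam := lam) hπ₁ hπ₂ u₀).eq_or_lt
      with hG | hG
    · obtain ⟨hF0, hl0⟩ := SparseInversion.eq_zero_of_Gam_eq_zero hd hπ₁ hπ₂ hG.symm
      refine ⟨1, one_pos, fun ε hε t ht => ⟨hint ε hε t ht.1 fun x => ‖x - u t‖ ^ 2, ?_⟩⟩
      have hut : u t = u₀ := SparseInversion.eqOn_Ici_of_isFlowOn (v := fun _ => u₀) hmon
        (fun _ => zero_le_one) (fun _ => hlam) hu0 hu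
        (fun T _ => SparseInversion.isFlowOn_const_of_eq_zero hF0 _ (fun _ => hl0) T) ht.1
      have hvt : ∀ ω, V ε (fun k => j k ω) t = u₀ := fun ω =>
        SparseInversion.eqOn_Ici_of_isFlowOn (v := fun _ => u₀) hmon
          (fun _ => SparseInversion.lsRate_nonneg hπ₁ _)
          (fun _ => mul_nonneg (SparseInversion.shrinkRate_nonneg hπ₂ _) hlam)
          (hV ε hε fun k => j k ω).1 (hV ε hε fun k => j k ω).2
          (fun T _ => SparseInversion.isFlowOn_const_of_eq_zero hF0 _
            (fun _ => by rw [hl0, mul_zero]) T) ht.1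
      have hI := intervalIntegral.integral_nonneg hT.le (μ := volume) fun s _ => hG0 s
      simp only [hut, hvt, sub_self, norm_zero, ne_eq, OfNat.ofNat_ne_zero, not_false_eq_true,
        zero_pow, integral_zero]
      positivity
    · have hI := intervalIntegral.integral_pos hT hGc (fun s _ => hG0 s)
        ⟨0, ⟨le_rfl, hT.le⟩, by rwa [hu0]⟩
      obtain ⟨C, hC, h⟩ := hmean T hT.le
      refine ⟨(C + 1) / ∫ s in (0 : ℝ)..T, SparseInversion.Gam A b lam π₁ π₂ (u s), by positivity,
        fun ε hε t ht => ⟨hint ε hε t ht.1 fun x => ‖x - u t‖ ^ 2, (h ε hε t ht).trans ?_⟩⟩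
      rw [mul_right_comm, div_mul_cancel₀ _ hI.ne']
      exact mul_le_mul_of_nonneg_right (by linarith) hε.le
  · intro η hη
    -- One third of `η` each for the gap between `Φ(u T)` and the minimum, the slack in Young's
    -- inequality, and `S` times the mean square error.
    obtain ⟨δ, hδ, hball⟩ := Metric.continuousAt_iff.1
      (SparseInversion.continuous_objective A b lam).continuousAt (η / 3) (by positivity)
    obtain ⟨T, hT, huT⟩ := hlim (δ / 2) (by positivity)
    have h1 : SparseInversion.objective A b lam (u T) ≤
        SparseInversion.objective A b lam y + η / 3 := by
      have h2 := hball (x := u T) (by rw [dist_eq_norm]; linarith)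
      have h3 := (abs_lt.1 h2).2
      linarith
    have h2 : SparseInversion.objective A b lam y ≤ ⨅ w, SparseInversion.objective A b lam w :=
      le_ciInf hy
    obtain ⟨R, L, hR, -, hb, -⟩ :=
      SparseInversion.exists_forall_isFlowFamily_bounds hK hmon hlam hπ₁ hπ₂ u₀ T hT.le
    obtain ⟨C, hC, h⟩ := hmean T hT.le
    set S := (K * R + ‖SparseInversion.lsGrad A b 0‖ + lam * Real.sqrt d) ^ 2 / (4 * (η / 3))
      with hS
    have hS0 : 0 ≤ S := by positivity
    refine ⟨T, hT, η / 3 / (S * C + 1), by positivity, fun ε hε hε0 =>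
      ⟨hint ε hε T hT.le _, ?_⟩⟩
    have hsq := hint ε hε T hT.le fun x => ‖x - u T‖ ^ 2
    have h3 := integral_mono (hint ε hε T hT.le (SparseInversion.objective A b lam))
      ((integrable_const (SparseInversion.objective A b lam (u T) + η / 3)).fun_add
        (hsq.const_mul S))
      (fun ω => SparseInversion.objective_le_add hK hlam
        ((hb ε (V ε) (hV ε hε) _).1 T ⟨hT.le, le_rfl⟩) (by positivity : 0 < η / 3))
    rw [integral_add (integrable_const _) (hsq.const_mul S), integral_const_mul, integral_const,
      probReal_univ, one_smul] at h3
    have h4 := mul_le_mul_of_nonneg_left (h ε hε T ⟨hT.le, le_rfl⟩) hS0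
    have h5 := (lt_div_iff₀ (by positivity)).1 hε0
    linarith
  · intro η hη
    -- From `‖x + y‖² ≤ 2 ‖x‖² + 2 ‖y‖²`, with both squared terms at most `η / 4`, the first in
    -- expectation.
    obtain ⟨T, hT, huT⟩ := hlim (Real.sqrt (η / 4)) (by positivity)
    have h1 : ‖u T - y‖ ^ 2 ≤ η / 4 := by
      have := pow_le_pow_left₀ (norm_nonneg _) huT 2
      rwa [Real.sq_sqrt (by positivity)] at this
    obtain ⟨C, hC, h⟩ := hmean T hT.le
    refine ⟨T, hT, η / 4 / (C + 1), by positivity, fun ε hε hε0 =>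
      ⟨hint ε hε T hT.le fun x => ‖x - y‖ ^ 2, ?_⟩⟩
    have hsq := hint ε hε T hT.le fun x => ‖x - u T‖ ^ 2
    have h3 := integral_mono (hint ε hε T hT.le fun x => ‖x - y‖ ^ 2)
      ((hsq.const_mul 2).fun_add (integrable_const (2 * ‖u T - y‖ ^ 2)))
      (fun ω => by
        have h4 := norm_add_le (V ε (fun k => j k ω) T - u T) (u T - y)
        rw [sub_add_sub_cancel] at h4
        have h5 := pow_le_pow_left₀ (norm_nonneg _) h4 2
        refine h5.trans ?_
        nlinarith [sq_nonneg (‖V ε (fun k => j k ω) T - u T‖ - ‖u T - y‖)])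
    rw [integral_add (hsq.const_mul 2) (integrable_const _), integral_const_mul, integral_const,
      probReal_univ, one_smul] at h3
    have h4 := h ε hε T ⟨hT.le, le_rfl⟩
    have h5 := (lt_div_iff₀ (by positivity)).1 hε0
    linarith
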